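/- Let $X$ be a real Banach space, $E$ a real Banach lattice (no form of Dedekind completeness is assumed), and $T:X\to E$ a bounded linear operator with adjoint $T':E'\to X'$. The dual $E'$ carries its usual order ($f\le g$ iff $f(x)\le g(x)$ for all $x\ge 0$), for which it is a lattice. A sequence $(x_n)$ in a vector lattice is disjoint if $|x_m|\wedge|x_n|=0$ for $m\ne n$, and order bounded if it lies in some order interval. The solid hull of $A\subset E$ is $\{y:|y|\le|x|\text{ for some }x\in A\}$; a norm bounded set $A\subset E$ is disjointly weakly compact if every disjoint sequence in its solid hull converges weakly to $0$. An $L$-sequence in $E'$ is a norm bounded sequence $(f_n)$ such that $\sup_n|f_n(x_k)|\to 0$ as $k\to\infty$ for every weakly null sequence $(x_k)$ in $E$. Then every disjoint $L$-sequence in $E'$ is weak* null, and the following statements are equivalent. 1. $T$ is disjointly weakly compact, that is, the image $T(B_X)$ of the closed unit ball is a disjointly weakly compact set. 2. $\|T'f_n\|\to 0$ for every order bounded weak* null sequence $(f_n)$ of positive elements of $E'$. 3. (a) $\|T'f_n\|\to 0$ for every disjoint $L$-sequence $(f_n)$ in $E'$; equivalently, (b) $T$ is almost $(L)$ limited, that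 is, $\|T'f_n\|\to 0$ for every disjoint weak* null $L$-sequence $(f_n)$ in $E'$. 4. (a) $\|T'f_n\|\to 0$ for every order bounded disjoint sequence $(f_n)$ in $E'$; equivalently, (b) $T'$ is order weakly compact, that is, $T'$ maps every order interval $[0,f]$, $0\le f\in E'$, to a relatively weakly compact subset of $X'$. 5. $\|T'f_n\|\to 0$ for every weak* null $L$-sequence $(f_n)$ of positive elements of $E'$. -/

import Mathlib

open Filter Topology

noncomputable section

/-! ### The Banach lattice dual

The norm dual `E'` of a normed vector lattice `E` is ordered by `f ≤ g ↔ f x ≤ g x` for all `x ≥ 0`.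
It is a lattice; suprema are given by the Riesz-Kantorovich formula. -/

namespace DualLattice

variable {E : Type*} [NormedAddCommGroup E] [Lattice E] [IsOrderedAddMonoid E] [HasSolidNorm E]
  [NormedSpace ℝ E]

/-- The order of the dual: `f ≤ g` iff `f x ≤ g x` for every `x ≥ 0`. -/
instance instPartialOrder : PartialOrder (StrongDual ℝ E) where
  le f g := ∀ x : E, 0 ≤ x → f x ≤ g x
  le_refl _ _ _ := le_rfl
  le_trans _ _ _ h₁ h₂ x hx := (h₁ x hx).trans (h₂ x hx)
  le_antisymm f g h₁ h₂ := by
    ext x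
    have h : ∀ y : E, 0 ≤ y → f y = g y := fun y hy => le_antisymm (h₁ y hy) (h₂ y hy)
    rw [← posPart_sub_negPart x, map_sub, map_sub, h _ (posPart_nonneg x), h _ (negPart_nonneg x)]

theorem le_def {f g : StrongDual ℝ E} : f ≤ g ↔ ∀ x : E, 0 ≤ x → f x ≤ g x := Iff.rfl

/-- For `x ≥ 0`, the value of the positive part: `f⁺(x) = sup {f y : 0 ≤ y ≤ x}`. -/
def posVal (f : StrongDual ℝ E) (x : E) : ℝ := sSup (f '' Set.Icc 0 x)

theorem norm_le_of_mem_Icc {x y : E} (hy : y ∈ Set.Icc 0 x) : ‖y‖ ≤ ‖x‖ := by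
  apply norm_le_norm_of_abs_le_abs
  rw [abs_of_nonneg hy.1, abs_of_nonneg (hy.1.trans hy.2)]
  exact hy.2

theorem posVal_bdd (f : StrongDual ℝ E) (x : E) : BddAbove (f '' Set.Icc 0 x) := by
  refine ⟨‖f‖ * ‖x‖, ?_⟩
  rintro _ ⟨y, hy, rfl⟩
  exact ((le_abs_self _).trans (f.le_opNorm y)).trans
    (mul_le_mul_of_nonneg_left (norm_le_of_mem_Icc hy) (norm_nonneg f))

theorem le_posVal (f : StrongDual ℝ E) {x y : E} (h0 : 0 ≤ y) (h : y ≤ x) : f y ≤ posVal f x :=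
  le_csSup (posVal_bdd f x) ⟨y, ⟨h0, h⟩, rfl⟩

theorem posVal_le (f : StrongDual ℝ E) {x : E} (hx : 0 ≤ x) {c : ℝ}
    (h : ∀ y, 0 ≤ y → y ≤ x → f y ≤ c) : posVal f x ≤ c := by
  refine csSup_le ⟨f 0, 0, ⟨le_rfl, hx⟩, rfl⟩ ?_
  rintro _ ⟨y, hy, rfl⟩
  exact h y hy.1 hy.2

theorem posVal_nonneg (f : StrongDual ℝ E) {x : E} (hx : 0 ≤ x) : 0 ≤ posVal f x := by
  simpa using le_posVal f le_rfl hx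

theorem posVal_le_norm (f : StrongDual ℝ E) {x : E} (hx : 0 ≤ x) : posVal f x ≤ ‖f‖ * ‖x‖ :=
  posVal_le f hx fun y h0 h => ((le_abs_self _).trans (f.le_opNorm y)).trans
    (mul_le_mul_of_nonneg_left (norm_le_of_mem_Icc ⟨h0, h⟩) (norm_nonneg f))

theorem posVal_add (f : StrongDual ℝ E) {x y : E} (hx : 0 ≤ x) (hy : 0 ≤ y) :
    posVal f (x + y) = posVal f x + posVal f y := by
  apply le_antisymm
  · refine posVal_le f (add_nonneg hx hy) fun z h0 h => ?_
    have h1 : f (z ⊓ x) ≤ posVal f x := le_posVal f (le_inf h0 hx) inf_le_right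
    have h2 : f (z - z ⊓ x) ≤ posVal f y := by
      refine le_posVal f (sub_nonneg.2 inf_le_left) ?_
      rw [sub_le_iff_le_add, add_inf]
      refine le_inf ?_ (by rwa [add_comm])
      exact le_add_of_nonneg_left hy
    have h3 : f z = f (z ⊓ x) + f (z - z ⊓ x) := by rw [← map_add, add_sub_cancel]
    linarith
  · rw [← le_sub_iff_add_le]
    refine posVal_le f hx fun a ha0 ha => ?_
    rw [le_sub_comm]
    refine posVal_le f hy fun b hb0 hb => ?_
    rw [le_sub_iff_add_le, add_comm, ← map_add]
    exact le_posVal f (add_nonneg ha0 hb0) (add_le_add ha hb)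

/-- The positive part `f⁺` of `f`, as an element of the dual. -/
def posPartDual (f : StrongDual ℝ E) : StrongDual ℝ E :=
  AddMonoidHom.toRealLinearMap
    { toFun := fun x => posVal f x⁺ - posVal f x⁻
      map_zero' := by simp
      map_add' := fun x y => by
        have key : (x + y)⁺ + (x⁻ + y⁻) = (x + y)⁻ + (x⁺ + y⁺) := by
          have h1 := posPart_sub_negPart (x + y)
          have h2 := posPart_sub_negPart x
          have h3 := posPart_sub_negPart y
          rw [← sub_eq_zero]
          calc (x + y)⁺ + (x⁻ + y⁻) - ((x + y)⁻ + (x⁺ + y⁺))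
              = ((x + y)⁺ - (x + y)⁻) - (x⁺ - x⁻) - (y⁺ - y⁻) := by abel
            _ = 0 := by rw [h1, h2, h3]; abel
        have h := congrArg (posVal f) key
        rw [posVal_add f (posPart_nonneg _) (add_nonneg (negPart_nonneg _) (negPart_nonneg _)),
          posVal_add f (negPart_nonneg x) (negPart_nonneg y),
          posVal_add f (negPart_nonneg _) (add_nonneg (posPart_nonneg _) (posPart_nonneg _)),
          posVal_add f (posPart_nonneg x) (posPart_nonneg y)] at h
        linarith }
    (AddMonoidHomClass.continuous_of_bound _ ‖f‖ fun x => by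
      have h1 := posVal_nonneg f (posPart_nonneg x)
      have h2 := posVal_nonneg f (negPart_nonneg x)
      have h3 := posVal_le_norm f (posPart_nonneg x)
      have h4 := posVal_le_norm f (negPart_nonneg x)
      have h5 : ‖x⁺‖ ≤ ‖x‖ := norm_le_norm_of_abs_le_abs (by
        rw [abs_of_nonneg (posPart_nonneg x)]; exact sup_le (le_abs_self x) (abs_nonneg x))
      have h6 : ‖x⁻‖ ≤ ‖x‖ := norm_le_norm_of_abs_le_abs (by
        rw [abs_of_nonneg (negPart_nonneg x)]; exact sup_le (neg_le_abs x) (abs_nonneg x))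
      have h7 := mul_le_mul_of_nonneg_left h5 (norm_nonneg f)
      have h8 := mul_le_mul_of_nonneg_left h6 (norm_nonneg f)
      change |posVal f x⁺ - posVal f x⁻| ≤ _
      rw [abs_le]
      constructor <;> linarith)

theorem posPartDual_apply (f : StrongDual ℝ E) {x : E} (hx : 0 ≤ x) :
    posPartDual f x = sSup (f '' Set.Icc 0 x) := by
  change posVal f x⁺ - posVal f x⁻ = posVal f x
  have h0 : posVal f (0 : E) = 0 := by simp [posVal]
  rw [posPart_of_nonneg hx, negPart_of_nonneg hx, h0, sub_zero]

/-- The lattice structure of the dual, `f ∨ g = (f - g)⁺ + g` and `f ∧ g = f - (f - g)⁺`. -/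
instance instLattice : Lattice (StrongDual ℝ E) where
  sup f g := posPartDual (f - g) + g
  inf f g := f - posPartDual (f - g)
  le_sup_left f g x hx := by
    have h := le_posVal (f - g) hx le_rfl
    have e := posPartDual_apply (f - g) hx
    change f x ≤ posPartDual (f - g) x + g x
    change f x - g x ≤ _ at h
    rw [e]
    exact sub_le_iff_le_add.1 h
  le_sup_right f g x hx := by
    have h := posVal_nonneg (f - g) hx
    have e := posPartDual_apply (f - g) hx
    change g x ≤ posPartDual (f - g) x + g x
    rw [e]
    exact le_add_of_nonneg_left h
  sup_le f g k hf hg x hx := by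
    have e := posPartDual_apply (f - g) hx
    change posPartDual (f - g) x + g x ≤ k x
    rw [e, ← le_sub_iff_add_le]
    refine posVal_le (f - g) hx fun y h0 h => ?_
    have h1 := hf y h0
    have h2 := hg (x - y) (sub_nonneg.2 h)
    rw [map_sub, map_sub] at h2
    change f y - g y ≤ _
    linarith
  inf_le_left f g x hx := by
    have h := posVal_nonneg (f - g) hx
    have e := posPartDual_apply (f - g) hx
    change f x - posPartDual (f - g) x ≤ f x
    rw [e]
    exact sub_le_self _ h
  inf_le_right f g x hx := by
    have h := le_posVal (f - g) hx le_rfl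
    have e := posPartDual_apply (f - g) hx
    change f x - posPartDual (f - g) x ≤ g x
    change f x - g x ≤ _ at h
    rw [e]
    exact sub_le_comm.1 h
  le_inf k f g hf hg x hx := by
    have e := posPartDual_apply (f - g) hx
    change k x ≤ f x - posPartDual (f - g) x
    rw [e, le_sub_comm]
    refine posVal_le (f - g) hx fun y h0 h => ?_
    have h1 := hg y h0
    have h2 := hf (x - y) (sub_nonneg.2 h)
    rw [map_sub, map_sub] at h2
    change f y - g y ≤ _
    linarith

end DualLattice

/-! ### Sequences and sets -/

/-- A sequence in a vector lattice with pairwise disjoint terms, `|x m| ∧ |x n| = 0` for `m ≠ n`. -/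
def IsDisjointSeq {F : Type*} [Lattice F] [AddCommGroup F] (x : ℕ → F) : Prop :=
  ∀ m n : ℕ, m ≠ n → |x m| ⊓ |x n| = 0

/-- A sequence contained in some order interval `[a, b]`. -/
def IsOrderBoundedSeq {F : Type*} [Preorder F] (x : ℕ → F) : Prop :=
  ∃ a b : F, ∀ n, x n ∈ Set.Icc a b

/-- Convergence to zero in the weak topology. -/
def IsWeaklyNull {X : Type*} [NormedAddCommGroup X] [NormedSpace ℝ X] (x : ℕ → X) : Prop :=
  Tendsto (fun n => toWeakSpace ℝ X (x n)) atTop (𝓝 0)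

/-- Convergence to zero in the weak* topology of the dual. -/
def IsWeakStarNull {X : Type*} [NormedAddCommGroup X] [NormedSpace ℝ X]
    (f : ℕ → StrongDual ℝ X) : Prop :=
  Tendsto (fun n => StrongDual.toWeakDual (f n)) atTop (𝓝 0)

/-- A norm bounded set `B` of functionals on which every weakly null sequence converges
uniformly to zero. -/
def IsLSet {X : Type*} [NormedAddCommGroup X] [NormedSpace ℝ X]
    (B : Set (StrongDual ℝ X)) : Prop :=
  Bornology.IsBounded B ∧ ∀ x : ℕ → X, IsWeaklyNull x →
    TendstoUniformlyOn (fun n (f : StrongDual ℝ X) => f (x n)) (fun _ => 0) atTop B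

/-- A sequence of functionals whose set of terms is an `L`-set. -/
def IsLSequence {X : Type*} [NormedAddCommGroup X] [NormedSpace ℝ X]
    (f : ℕ → StrongDual ℝ X) : Prop :=
  IsLSet (Set.range f)

/-- A norm bounded set such that every disjoint sequence in its solid hull is weakly null. -/
def IsDisjointlyWeaklyCompactSet {E : Type*} [NormedAddCommGroup E] [Lattice E]
    [NormedSpace ℝ E] (A : Set E) : Prop :=
  Bornology.IsBounded A ∧ ∀ x : ℕ → E, (∀ n, x n ∈ LatticeOrderedAddCommGroup.solidClosure A) →
    IsDisjointSeq x → IsWeaklyNull x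

/-- A set whose closure in the weak topology is weakly compact. -/
def IsRelativelyWeaklyCompact {X : Type*} [NormedAddCommGroup X] [NormedSpace ℝ X]
    (A : Set X) : Prop :=
  IsCompact (closure (toWeakSpace ℝ X '' A))

/-! ### Operators -/

/-- The adjoint `T' : E' → X'`, `T' f = f ∘ T`. -/
def dualOperator {X E : Type*} [NormedAddCommGroup X] [NormedSpace ℝ X] [NormedAddCommGroup E]
    [NormedSpace ℝ E] (T : X →L[ℝ] E) : StrongDual ℝ E →L[ℝ] StrongDual ℝ X :=
  ContinuousLinearMap.precomp ℝ T

theorem dualOperator_apply {X E : Type*} [NormedAddCommGroup X] [NormedSpace ℝ X]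
    [NormedAddCommGroup E] [NormedSpace ℝ E] (T : X →L[ℝ] E) (f : StrongDual ℝ E) (x : X) :
    dualOperator T f x = f (T x) := rfl

/-- `T` maps the closed unit ball to a disjointly weakly compact set. -/
def IsDisjointlyWeaklyCompactOperator {X E : Type*} [NormedAddCommGroup X] [NormedSpace ℝ X]
    [NormedAddCommGroup E] [Lattice E] [NormedSpace ℝ E] (T : X →L[ℝ] E) : Prop :=
  IsDisjointlyWeaklyCompactSet (T '' Metric.closedBall 0 1)

/-- `T` is almost (L) limited: `‖T' f n‖ → 0` for every disjoint weak* null `L`-sequence. -/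
def IsAlmostLLimited {X E : Type*} [NormedAddCommGroup X] [NormedSpace ℝ X]
    [NormedAddCommGroup E] [Lattice E] [IsOrderedAddMonoid E] [HasSolidNorm E] [NormedSpace ℝ E]
    (T : X →L[ℝ] E) : Prop :=
  ∀ f : ℕ → StrongDual ℝ E, IsDisjointSeq f → IsLSequence f → IsWeakStarNull f →
    Tendsto (fun n => ‖dualOperator T (f n)‖) atTop (𝓝 0)

/-- An operator from a vector lattice to a normed space that maps every order interval `[0, x]`
to a relatively weakly compact set. -/
def IsOrderWeaklyCompactOperator {F Y : Type*} [NormedAddCommGroup F] [PartialOrder F]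
    [NormedSpace ℝ F] [NormedAddCommGroup Y] [NormedSpace ℝ Y] (S : F →L[ℝ] Y) : Prop :=
  ∀ x : F, 0 ≤ x → IsRelativelyWeaklyCompact (S '' Set.Icc 0 x)

end

noncomputable section

/-! ### Disjointness in vector lattices -/

section LatticeGroup

variable {F : Type*} [Lattice F] [AddCommGroup F] [IsOrderedAddMonoid F]

/-! The pivot is the condition on order bounded disjoint sequences in `E'`: disjoint weak
compactness of `T` implies every other condition, each of these implies the pivot, and the pivot
gives back disjoint weak compactness.

From `T` outwards, the tool is equi-integrability. Let `G` be a norm bounded set of positive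
functionals such that `g k (y k) → 0` for `g k` in `G` and disjoint positive `y` in the solid hull
of the image of the ball. Then one `u ≥ 0` makes `g (|T b| - u)⁺` small for all `g` in `G` and `‖b‖
≤ 1`; otherwise recursively chosen `T b` disjointify into a sequence on which the functionals stay
large. If `|f n| ≤ g n`, then `|f n (T b)| ≤ g n u + g n (|T b| - u)⁺`, so `g n u → 0` gives norm
convergence. For a disjoint `L`-sequence, `g n = |f n|` is weak* null: disjoint functionals large at
`u` would stay large along a disjoint sequence in `[0, u]`, where every dominated sequence is weakly
null.

For the adjoint, equi-integrability with one functional `f` shows that each `L` in the unit ball of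
`X''` is uniformly approximated on the adjoint image of `[0, f]` by points of `X`. This combines
Goldstine's theorem with a lattice version of the uniform convexity of the square. Hence the weak*
closure of that image in the third dual adds no new points, which gives weak compactness.

Towards the pivot, a Schur-type Baire argument shows that order bounded disjoint positive sequences
in `E'` are `L`-sequences, hence weak* null; applied to order weakly compact adjoints, it gives norm
convergence directly. Finally, given disjoint `x n` with `|x n| ≤ |T (b n)|` and a functional `φ`,
restricting `|φ|` to the bands of the `|x n|` and correcting signs gives disjoint functionals whose
values at `T (b n)` dominate `|φ (x n)|`. -/

theorem add_inf_le_inf_add_inf {a b c : F} (ha : 0 ≤ a) (hb : 0 ≤ b) (hc : 0 ≤ c) :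
    (a + b) ⊓ c ≤ a ⊓ c + b ⊓ c := by
  rw [inf_add, add_inf, add_inf]
  refine le_inf (le_inf inf_le_left (inf_le_right.trans ?_)) (le_inf (inf_le_right.trans ?_)
    (inf_le_right.trans ?_))
  · exact le_add_of_nonneg_left ha
  · exact le_add_of_nonneg_right hb
  · exact le_add_of_nonneg_right hc

theorem add_inf_eq_zero {a b c : F} (ha : 0 ≤ a) (hb : 0 ≤ b) (hc : 0 ≤ c) (hac : a ⊓ c = 0)
    (hbc : b ⊓ c = 0) : (a + b) ⊓ c = 0 :=
  le_antisymm ((add_inf_le_inf_add_inf ha hb hc).trans (by rw [hac, hbc, add_zero]))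
    (le_inf (add_nonneg ha hb) hc)

theorem inf_eq_zero_of_le {a b c d : F} (ha : 0 ≤ a) (hb : 0 ≤ b) (hac : a ≤ c) (hbd : b ≤ d)
    (h : c ⊓ d = 0) : a ⊓ b = 0 :=
  le_antisymm ((inf_le_inf hac hbd).trans h.le) (le_inf ha hb)

theorem add_le_of_inf_eq_zero {a b u : F} (h : a ⊓ b = 0) (ha : a ≤ u) (hb : b ≤ u) :
    a + b ≤ u := by
  rw [← inf_add_sup, h, zero_add]
  exact sup_le ha hb

theorem sum_inf_eq_zero {ι : Type*} {x : ι → F} {c : F} (hx : ∀ i, 0 ≤ x i) (hc : 0 ≤ c)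
    (s : Finset ι) (h : ∀ i ∈ s, x i ⊓ c = 0) : (∑ i ∈ s, x i) ⊓ c = 0 := by
  classical
  induction s using Finset.induction_on with
  | empty => simpa using hc
  | insert i s hi ih =>
    rw [Finset.sum_insert hi]
    exact add_inf_eq_zero (hx i) (Finset.sum_nonneg fun j _ => hx j) hc
      (h i (Finset.mem_insert_self i s)) (ih fun j hj => h j (Finset.mem_insert_of_mem hj))

/-- A finite sum of pairwise disjoint positive elements below `u` is below `u`. -/
theorem sum_le_of_disjoint {ι : Type*} {x : ι → F} {u : F} (hu : 0 ≤ u) (hx : ∀ i, 0 ≤ x i)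
    (s : Finset ι) (hxu : ∀ i ∈ s, x i ≤ u)
    (hd : ∀ i ∈ s, ∀ j ∈ s, i ≠ j → x i ⊓ x j = 0) : ∑ i ∈ s, x i ≤ u := by
  classical
  induction s using Finset.induction_on with
  | empty => simpa using hu
  | insert i s hi ih =>
    rw [Finset.sum_insert hi, add_comm]
    refine add_le_of_inf_eq_zero (sum_inf_eq_zero hx (hx i) s fun j hj => ?_) ?_ ?_
    · exact hd j (Finset.mem_insert_of_mem hj) i (Finset.mem_insert_self i s)
        fun h => hi (h ▸ hj)
    · exact ih (fun j hj => hxu j (Finset.mem_insert_of_mem hj)) fun j hj k hk =>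
        hd j (Finset.mem_insert_of_mem hj) k (Finset.mem_insert_of_mem hk)
    · exact hxu i (Finset.mem_insert_self i s)

theorem isDisjointSeq_of_nonneg {x : ℕ → F} (hx : ∀ n, 0 ≤ x n)
    (h : ∀ m n, m < n → x m ⊓ x n = 0) : IsDisjointSeq x := by
  intro m n hmn
  rw [abs_of_nonneg (hx m), abs_of_nonneg (hx n)]
  rcases hmn.lt_or_gt with h1 | h1
  · exact h m n h1
  · rw [inf_comm]; exact h n m h1

theorem IsDisjointSeq.of_abs_le {x y : ℕ → F} (hx : IsDisjointSeq x) (h : ∀ n, |y n| ≤ |x n|) :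
    IsDisjointSeq y := fun m n hmn =>
  inf_eq_zero_of_le (abs_nonneg _) (abs_nonneg _) (h m) (h n) (hx m n hmn)

theorem IsDisjointSeq.abs {x : ℕ → F} (hx : IsDisjointSeq x) : IsDisjointSeq fun n => |x n| :=
  hx.of_abs_le fun n => by rw [abs_abs]

theorem IsDisjointSeq.comp {x : ℕ → F} (hx : IsDisjointSeq x) {φ : ℕ → ℕ}
    (hφ : Function.Injective φ) : IsDisjointSeq (x ∘ φ) := fun _ _ hmn =>
  hx _ _ fun h => hmn (hφ h)

theorem posPart_le_abs (x : F) : x⁺ ≤ |x| := sup_le (le_abs_self x) (abs_nonneg x)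

theorem negPart_le_abs (x : F) : x⁻ ≤ |x| := sup_le (neg_le_abs x) (abs_nonneg x)

theorem IsDisjointSeq.posPart {x : ℕ → F} (hx : IsDisjointSeq x) : IsDisjointSeq fun n => (x n)⁺ :=
  hx.of_abs_le fun n => by rw [abs_of_nonneg (posPart_nonneg _)]; exact posPart_le_abs _

theorem IsDisjointSeq.negPart {x : ℕ → F} (hx : IsDisjointSeq x) : IsDisjointSeq fun n => (x n)⁻ :=
  hx.of_abs_le fun n => by rw [abs_of_nonneg (negPart_nonneg _)]; exact negPart_le_abs _

variable [Module ℝ F] [IsOrderedModule ℝ F]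

theorem inf_smul_eq_zero {a b : F} (ha : 0 ≤ a) (hb : 0 ≤ b) (h : a ⊓ b = 0) {c : ℝ}
    (hc : 0 ≤ c) : a ⊓ c • b = 0 := by
  obtain ⟨n, hn⟩ := exists_nat_ge c
  have h1 : a ⊓ (n • b) = 0 := by
    have := sum_inf_eq_zero (x := fun _ : ℕ => b) (c := a) (fun _ => hb) ha (Finset.range n)
      fun _ _ => by rw [inf_comm]; exact h
    rw [inf_comm]; simpa using this
  refine inf_eq_zero_of_le ha (smul_nonneg hc hb) le_rfl ?_ h1
  rw [← Nat.cast_smul_eq_nsmul ℝ]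
  exact smul_le_smul_of_nonneg_right hn hb

/-- The basic mechanism producing disjoint elements: `(a - C b)⁺` and `(b - a / C)⁺` are
disjoint. -/
theorem inf_eq_zero_of_le_posPart_sub {a b p q : F} {C : ℝ} (hC : 0 < C) (hp : 0 ≤ p)
    (hq : 0 ≤ q) (hpa : p ≤ (a - C • b)⁺) (hqb : q ≤ (b - C⁻¹ • a)⁺) : p ⊓ q = 0 := by
  refine inf_eq_zero_of_le (d := C⁻¹ • (a - C • b)⁻) hp hq hpa (hqb.trans ?_)
    (inf_smul_eq_zero (posPart_nonneg _) (negPart_nonneg _) (posPart_inf_negPart_eq_zero _)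
      (inv_nonneg.2 hC.le))
  refine sup_le ?_ (smul_nonneg (inv_nonneg.2 hC.le) (negPart_nonneg _))
  calc b - C⁻¹ • a = C⁻¹ • (-(a - C • b)) := by
        rw [neg_sub, smul_sub, smul_smul, inv_mul_cancel₀ hC.ne', one_smul]
    _ ≤ _ := smul_le_smul_of_nonneg_left (neg_le_negPart _) (inv_nonneg.2 hC.le)

/-- Disjointification: a sequence `x` with `x n ≤ M n • w` yields a disjoint sequence
`(x n - K n • ∑ i < n, x i - θ n • w)⁺`. -/
theorem disjointify {x : ℕ → F} {w : F} {M K θ : ℕ → ℝ} (hx : ∀ n, 0 ≤ x n)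
    (hM : ∀ n, 0 < M n) (hK : ∀ n, 0 < K n) (hθ : ∀ n, 0 < θ n) (hxw : ∀ n, x n ≤ M n • w)
    (hKθ : ∀ i n, i < n → M n ≤ K n * θ i) :
    IsDisjointSeq fun n => (x n - K n • ∑ i ∈ Finset.range n, x i - θ n • w)⁺ := by
  have hw : 0 ≤ w := by
    have := smul_nonneg (inv_nonneg.2 (hM 0).le) ((hx 0).trans (hxw 0))
    rwa [smul_smul, inv_mul_cancel₀ (hM 0).ne', one_smul] at this
  refine isDisjointSeq_of_nonneg (fun n => posPart_nonneg _) fun m n hmn => ?_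
  rw [inf_comm]
  refine inf_eq_zero_of_le_posPart_sub (hK n) (posPart_nonneg _) (posPart_nonneg _)
    (a := x n) (b := x m) (posPart_mono ?_) (posPart_mono ?_)
  · have h1 : x m ≤ ∑ i ∈ Finset.range n, x i :=
      Finset.single_le_sum (fun i _ => hx i) (Finset.mem_range.2 hmn)
    have h2 := smul_le_smul_of_nonneg_left h1 (hK n).le
    have h3 := smul_nonneg (hθ n).le hw
    calc _ ≤ x n - K n • ∑ i ∈ Finset.range n, x i := sub_le_self _ h3
      _ ≤ _ := sub_le_sub_left h2 _
  -- Later terms are not available when the `m`-th one is formed; subtracting `θ m • w` dominates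
  -- `(K n)⁻¹ • x n` for every `n > m` at once.
  · have h1 : (K n)⁻¹ • x n ≤ θ m • w := by
      refine (smul_le_smul_of_nonneg_left (hxw n) (inv_nonneg.2 (hK n).le)).trans ?_
      rw [smul_smul]
      refine smul_le_smul_of_nonneg_right ?_ hw
      rw [inv_mul_le_iff₀ (hK n)]
      exact hKθ m n hmn
    have h2 := smul_nonneg (hK m).le (Finset.sum_nonneg (s := Finset.range m) fun i _ => hx i)
    calc _ ≤ x m - θ m • w := sub_le_sub_right (sub_le_self _ h2) _
      _ ≤ _ := sub_le_sub_left h1 _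

end LatticeGroup

/-! ### The Schur property -/

/-- If `∑ n ∈ a, b m n → 0` as `m → ∞` for every set `a`, then `b m n → 0` uniformly in `n`. -/
theorem tendsto_zero_uniformly_of_tsum_indicator {b : ℕ → ℕ → ℝ} (hs : ∀ m, Summable (b m))
    (h : ∀ a : Set ℕ, Tendsto (fun m => ∑' n, a.indicator (b m) n) atTop (𝓝 0)) {ε : ℝ}
    (hε : 0 < ε) : ∀ᶠ m in atTop, ∀ n, |b m n| ≤ ε := by
  -- Subsets of `ℕ` are points of the Cantor space, where each subset sum is continuous and Baire's
  -- theorem applies.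
  let S : ℕ → (ℕ → Bool) → ℝ := fun m a => ∑' n, if a n then b m n else 0
  have hSc : ∀ m, Continuous (S m) := by
    intro m
    refine continuous_tsum (u := fun n => |b m n|) (fun n => ?_) (hs m).abs fun n a => ?_
    · exact (continuous_of_discreteTopology (f := fun t : Bool => if t then b m n else 0)).comp
        (continuous_apply n)
    · by_cases ha : a n <;> simp [ha]
  have hS : ∀ a, Tendsto (fun m => S m a) atTop (𝓝 0) := by
    intro a
    refine (h {n | a n = true}).congr fun m => tsum_congr fun n => ?_
    by_cases ha : a n <;> simp [Set.indicator, ha]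
  let C : ℕ → Set (ℕ → Bool) := fun k => ⋂ m ≥ k, {a | |S m a| ≤ ε / 2}
  have hCc : ∀ k, IsClosed (C k) := fun k =>
    isClosed_biInter fun m _ => isClosed_le (hSc m).abs continuous_const
  have hCu : ⋃ k, C k = Set.univ := by
    refine Set.eq_univ_of_forall fun a => ?_
    have h1 : ∀ᶠ m in atTop, |S m a| < ε / 2 := by
      have := (hS a).abs
      rw [abs_zero] at this
      exact this.eventually_lt_const (half_pos hε)
    obtain ⟨k, hk⟩ := eventually_atTop.1 h1
    exact Set.mem_iUnion.2 ⟨k, Set.mem_iInter₂.2 fun m hm => (hk m hm).le⟩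
  obtain ⟨k, a, ha⟩ := nonempty_interior_of_iUnion_of_closed hCc hCu
  -- Changing a late coordinate of an interior point stays in `C k`; the two choices at `n` give
  -- subset sums differing by exactly `b m n`.
  have hup : ∀ t : Bool, ∀ᶠ n in atTop, Function.update a n t ∈ C k := by
    intro t
    have : Tendsto (fun n => Function.update a n t) atTop (𝓝 a) := by
      refine tendsto_pi_nhds.2 fun i => tendsto_const_nhds.congr' ?_
      filter_upwards [eventually_gt_atTop i] with n hn
      rw [Function.update_of_ne hn.ne]
    exact (this.eventually (mem_interior_iff_mem_nhds.1 ha)).mono fun n hn => hn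
  obtain ⟨N, hN⟩ := eventually_atTop.1 ((hup true).and (hup false))
  have h2 : ∀ m ≥ k, ∀ n ≥ N, |b m n| ≤ ε := by
    intro m hm n hn
    have e1 := Set.mem_iInter₂.1 (hN n hn).1 m hm
    have e2 := Set.mem_iInter₂.1 (hN n hn).2 m hm
    have hsum : ∀ c : ℕ → Bool, Summable fun n => if c n then b m n else 0 := fun c =>
      (hs m).abs.of_norm_bounded fun i => by by_cases hc : c i <;> simp [hc]
    have key : S m (Function.update a n true) - S m (Function.update a n false) = b m n := by
      rw [← (hsum _).tsum_sub (hsum _), tsum_eq_single n]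
      · simp
      · intro i hi
        simp [Function.update_of_ne hi]
    rw [← key]
    have e1' : |S m (Function.update a n true)| ≤ ε / 2 := e1
    have e2' : |S m (Function.update a n false)| ≤ ε / 2 := e2
    rw [abs_le] at e1' e2' ⊢
    constructor <;> linarith
  have h3 : ∀ᶠ m in atTop, ∀ n ∈ Finset.range N, |b m n| ≤ ε := by
    rw [Filter.eventually_all_finset]
    intro n _
    have h4 : Tendsto (fun m => b m n) atTop (𝓝 0) := by
      refine (h {n}).congr fun m => ?_
      rw [tsum_eq_single n]
      · simp
      · intro i hi; simp [hi]
    have := h4.abs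
    rw [abs_zero] at this
    exact this.eventually_le_const hε
  filter_upwards [h3, eventually_ge_atTop k] with m hm hk n
  rcases lt_or_ge n N with hn | hn
  · exact hm n (Finset.mem_range.2 hn)
  · exact h2 m hk n hn

/-! ### The dual of a normed lattice -/

namespace DualLattice

section NormedLattice

variable {E : Type*} [NormedAddCommGroup E] [Lattice E] [IsOrderedAddMonoid E] [HasSolidNorm E]
  [NormedSpace ℝ E]

instance instIsOrderedAddMonoid : IsOrderedAddMonoid (StrongDual ℝ E) where
  add_le_add_left f g h k x hx := by
    change f x + k x ≤ g x + k x
    exact add_le_add_left (h x hx) (k x)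

theorem apply_nonneg {f : StrongDual ℝ E} (hf : 0 ≤ f) {x : E} (hx : 0 ≤ x) : 0 ≤ f x := hf x hx

theorem apply_mono {f : StrongDual ℝ E} (hf : 0 ≤ f) {x y : E} (h : x ≤ y) : f x ≤ f y := by
  have : 0 ≤ f (y - x) := hf (y - x) (sub_nonneg.2 h)
  rw [map_sub] at this
  exact sub_nonneg.1 this

theorem abs_apply_le_of_nonneg (f : StrongDual ℝ E) {x : E} (hx : 0 ≤ x) : |f x| ≤ |f| x :=
  abs_le'.2 ⟨le_abs_self f x hx, neg_le_abs f x hx⟩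

theorem abs_apply_le (f : StrongDual ℝ E) (x : E) : |f x| ≤ |f| |x| := by
  have h1 := abs_apply_le_of_nonneg f (posPart_nonneg x)
  have h2 := abs_apply_le_of_nonneg f (negPart_nonneg x)
  have h3 : f x = f x⁺ - f x⁻ := by rw [← map_sub, posPart_sub_negPart]
  have h4 : |f| |x| = |f| x⁺ + |f| x⁻ := by rw [← map_add, posPart_add_negPart]
  rw [h3, h4]
  exact (abs_sub _ _).trans (add_le_add h1 h2)

theorem abs_apply_le_of_abs_le {f g : StrongDual ℝ E} (h : |f| ≤ g) (x : E) : |f x| ≤ g |x| :=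
  (abs_apply_le f x).trans (h _ (abs_nonneg x))

theorem apply_abs_le_of_nonneg {f g : StrongDual ℝ E} (hf : 0 ≤ f) (h : f ≤ g) (x : E) :
    |f x| ≤ g |x| :=
  abs_apply_le_of_abs_le (by rwa [abs_of_nonneg hf]) x

theorem abs_le_of_forall {f g : StrongDual ℝ E} (h : ∀ x, 0 ≤ x → |f x| ≤ g x) : |f| ≤ g :=
  abs_le'.2 ⟨fun x hx => (le_abs_self _).trans (h x hx), fun x hx => (neg_le_abs _).trans (h x hx)⟩

/-- The Riesz-Kantorovich formula for the modulus. -/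
theorem exists_abs_apply_lt (f : StrongDual ℝ E) {x : E} (hx : 0 ≤ x) {ε : ℝ} (hε : 0 < ε) :
    ∃ z : E, |z| ≤ x ∧ |f| x < f z + ε := by
  have h1 : |f| x = posVal (f - -f) x + (-f) x := by
    change posPartDual (f - -f) x + (-f) x = _
    rw [posPartDual_apply _ hx]; rfl
  have h2 : ∃ y ∈ Set.Icc 0 x, posVal (f - -f) x - ε < (f - -f) y := by
    obtain ⟨_, ⟨y, hy, rfl⟩, h⟩ := exists_lt_of_lt_csSup
      (s := (f - -f) '' Set.Icc 0 x) ⟨_, 0, ⟨le_rfl, hx⟩, rfl⟩ (sub_lt_self (posVal (f - -f) x) hε)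
    exact ⟨y, hy, h⟩
  obtain ⟨y, hy, h⟩ := h2
  refine ⟨y - (x - y), abs_le'.2 ⟨?_, ?_⟩, ?_⟩
  · exact (sub_le_self _ (sub_nonneg.2 hy.2)).trans hy.2
  · rw [neg_sub]
    exact (sub_le_self _ hy.1).trans (sub_le_self _ hy.1)
  · have h3 : (f - -f) y = f y + f y := by
      change f y - -(f y) = _
      ring
    have h4 : (-f) x = - f x := rfl
    rw [h1, h4, map_sub, map_sub]
    rw [h3] at h
    linarith

theorem abs_apply_le_opNorm (f : StrongDual ℝ E) {x : E} (hx : 0 ≤ x) : |f| x ≤ ‖f‖ * ‖x‖ := by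
  refine le_of_forall_pos_lt_add fun ε hε => ?_
  obtain ⟨z, hz, h⟩ := exists_abs_apply_lt f hx hε
  have h1 : ‖z‖ ≤ ‖x‖ := norm_le_norm_of_abs_le_abs (by rwa [abs_of_nonneg hx])
  have h2 := (le_abs_self _).trans (f.le_opNorm z)
  have h3 := mul_le_mul_of_nonneg_left h1 (norm_nonneg f)
  linarith

/-- The Riesz-Kantorovich formula for the infimum. -/
theorem exists_inf_apply_lt (f g : StrongDual ℝ E) {x : E} (hx : 0 ≤ x) {ε : ℝ} (hε : 0 < ε) :
    ∃ y : E, 0 ≤ y ∧ y ≤ x ∧ f (x - y) + g y < (f ⊓ g) x + ε := by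
  have h1 : (f ⊓ g) x = f x - posVal (f - g) x := by
    change f x - posPartDual (f - g) x = _
    rw [posPartDual_apply _ hx]; rfl
  obtain ⟨_, ⟨y, hy, rfl⟩, h⟩ := exists_lt_of_lt_csSup
      (s := (f - g) '' Set.Icc 0 x) ⟨_, 0, ⟨le_rfl, hx⟩, rfl⟩ (sub_lt_self (posVal (f - g) x) hε)
  refine ⟨y, hy.1, hy.2, ?_⟩
  have h3 : (f - g) y = f y - g y := rfl
  rw [h3] at h
  rw [h1, map_sub]
  linarith

theorem inf_eq_zero_of_forall {f g : StrongDual ℝ E} (hf : 0 ≤ f) (hg : 0 ≤ g)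
    (h : ∀ x, 0 ≤ x → (f ⊓ g) x ≤ 0) : f ⊓ g = 0 :=
  le_antisymm (fun x hx => h x hx) (le_inf hf hg)

theorem norm_le_of_abs_apply_le_apply_abs {f g : StrongDual ℝ E} (h : ∀ x, |f x| ≤ g |x|) :
    ‖f‖ ≤ ‖g‖ := by
  refine f.opNorm_le_bound (norm_nonneg g) fun x => ?_
  refine (h x).trans (((le_abs_self _).trans (g.le_opNorm _)).trans ?_)
  rw [norm_abs_eq_norm]

/-- A functional determined by an additive function on the positive cone with
`0 ≤ p x ≤ f x` there. -/
def ofPosAdditive (f : StrongDual ℝ E) (p : E → ℝ) (h0 : ∀ x, 0 ≤ x → 0 ≤ p x)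
    (hf : ∀ x, 0 ≤ x → p x ≤ f x) (hadd : ∀ x y, 0 ≤ x → 0 ≤ y → p (x + y) = p x + p y) :
    StrongDual ℝ E :=
  AddMonoidHom.toRealLinearMap
    { toFun := fun x => p x⁺ - p x⁻
      map_zero' := by simp
      map_add' := fun x y => by
        have key : (x + y)⁺ + (x⁻ + y⁻) = (x + y)⁻ + (x⁺ + y⁺) := by
          have h1 := posPart_sub_negPart (x + y)
          have h2 := posPart_sub_negPart x
          have h3 := posPart_sub_negPart y
          rw [← sub_eq_zero]
          calc (x + y)⁺ + (x⁻ + y⁻) - ((x + y)⁻ + (x⁺ + y⁺))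
              = ((x + y)⁺ - (x + y)⁻) - (x⁺ - x⁻) - (y⁺ - y⁻) := by abel
            _ = 0 := by rw [h1, h2, h3]; abel
        have h := congrArg p key
        rw [hadd _ _ (posPart_nonneg _) (add_nonneg (negPart_nonneg _) (negPart_nonneg _)),
          hadd _ _ (negPart_nonneg x) (negPart_nonneg y),
          hadd _ _ (negPart_nonneg _) (add_nonneg (posPart_nonneg _) (posPart_nonneg _)),
          hadd _ _ (posPart_nonneg x) (posPart_nonneg y)] at h
        linarith }
    (AddMonoidHomClass.continuous_of_bound _ ‖f‖ fun x => by
      have h1 := h0 _ (posPart_nonneg x)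
      have h2 := h0 _ (negPart_nonneg x)
      have h3 := hf _ (posPart_nonneg x)
      have h4 := hf _ (negPart_nonneg x)
      have h5 : f |x| = f x⁺ + f x⁻ := by rw [← map_add, posPart_add_negPart]
      have h6 := (le_abs_self _).trans (f.le_opNorm |x|)
      rw [norm_abs_eq_norm] at h6
      change |p x⁺ - p x⁻| ≤ _
      rw [abs_le]
      constructor <;> linarith)

theorem ofPosAdditive_apply {f : StrongDual ℝ E} {p : E → ℝ} (h0 : ∀ x, 0 ≤ x → 0 ≤ p x)
    (hf : ∀ x, 0 ≤ x → p x ≤ f x) (hadd : ∀ x y, 0 ≤ x → 0 ≤ y → p (x + y) = p x + p y)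
    {x : E} (hx : 0 ≤ x) : ofPosAdditive f p h0 hf hadd x = p x := by
  change p x⁺ - p x⁻ = p x
  have : p 0 = 0 := by
    have := hadd 0 0 le_rfl le_rfl
    rw [add_zero] at this
    linarith
  rw [posPart_of_nonneg hx, negPart_of_nonneg hx, this, sub_zero]

end NormedLattice

end DualLattice

open DualLattice

/-! ### Null sequences -/

section Null

variable {X : Type*} [NormedAddCommGroup X] [NormedSpace ℝ X]

theorem tendsto_toWeakSpace_iff {ι : Type*} {l : Filter ι} {x : ι → X} {y : X} :
    Tendsto (fun n => toWeakSpace ℝ X (x n)) l (𝓝 (toWeakSpace ℝ X y)) ↔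
      ∀ φ : StrongDual ℝ X, Tendsto (fun n => φ (x n)) l (𝓝 (φ y)) := by
  have hinj : Function.Injective (topDualPairing ℝ X).flip := by
    intro a b hab
    refine (SeparatingDual.eq_iff_forall_dual_eq (R := ℝ)).2 fun φ => ?_
    exact congrArg (fun L => L φ) hab
  exact WeakBilin.tendsto_iff_forall_eval_tendsto (B := (topDualPairing ℝ X).flip) hinj

theorem isWeaklyNull_iff {x : ℕ → X} :
    IsWeaklyNull x ↔ ∀ φ : StrongDual ℝ X, Tendsto (fun n => φ (x n)) atTop (𝓝 0) := by
  have := tendsto_toWeakSpace_iff (l := atTop) (x := x) (y := 0)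
  simp only [map_zero] at this
  exact this

theorem isWeakStarNull_iff {f : ℕ → StrongDual ℝ X} :
    IsWeakStarNull f ↔ ∀ x : X, Tendsto (fun n => f n x) atTop (𝓝 0) :=
  tendsto_iff_forall_eval_tendsto_topDualPairing

theorem IsLSequence.exists_norm_le {f : ℕ → StrongDual ℝ X} (hf : IsLSequence f) :
    ∃ C, ∀ n, ‖f n‖ ≤ C := by
  obtain ⟨C, hC⟩ := hf.1.exists_norm_le
  exact ⟨C, fun n => hC _ ⟨n, rfl⟩⟩

/-- Convergence is uniform over the set of terms, so the index of the functional may depend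
arbitrarily on `k`. This is the form in which the `L`-property is used. -/
theorem IsLSequence.tendsto_apply {f : ℕ → StrongDual ℝ X} (hf : IsLSequence f) {x : ℕ → X}
    (hx : IsWeaklyNull x) (m : ℕ → ℕ) : Tendsto (fun k => f (m k) (x k)) atTop (𝓝 0) := by
  have h := hf.2 x hx
  rw [Metric.tendstoUniformlyOn_iff] at h
  rw [Metric.tendsto_nhds]
  intro ε hε
  filter_upwards [h ε hε] with k hk
  rw [dist_comm]
  exact hk _ ⟨m k, rfl⟩

theorem IsLSequence.comp {f : ℕ → StrongDual ℝ X} (hf : IsLSequence f) (φ : ℕ → ℕ) :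
    IsLSequence (f ∘ φ) :=
  ⟨hf.1.subset (Set.range_comp_subset_range _ _),
    fun x hx => (hf.2 x hx).mono (Set.range_comp_subset_range _ _)⟩

end Null

/-! ### Weakly null sequences and moduli of `L`-sequences. -/

section NullLattice

variable {E : Type*} [NormedAddCommGroup E] [Lattice E] [IsOrderedAddMonoid E] [HasSolidNorm E]
  [NormedSpace ℝ E]

/-- Order bounded disjoint sequences are weakly null. -/
theorem IsDisjointSeq.isWeaklyNull {x : ℕ → E} (hx : IsDisjointSeq x) {u : E}
    (hu : ∀ n, |x n| ≤ u) : IsWeaklyNull x := by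
  rw [isWeaklyNull_iff]
  intro φ
  -- By disjointness the finite sums of `|x n|` remain below `u`, so the values of `φ` are
  -- absolutely summable.
  have h1 : ∀ s : Finset ℕ, ∑ n ∈ s, |φ (x n)| ≤ |φ| u := fun s => calc
    ∑ n ∈ s, |φ (x n)| ≤ ∑ n ∈ s, |φ| |x n| := Finset.sum_le_sum fun n _ => abs_apply_le φ _
    _ = |φ| (∑ n ∈ s, |x n|) := (map_sum _ _ _).symm
    _ ≤ |φ| u := apply_mono (abs_nonneg φ) (sum_le_of_disjoint ((abs_nonneg _).trans (hu 0))
        (fun n => abs_nonneg _) s (fun n _ => hu n) fun m _ n _ hmn => hx m n hmn)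
  have h2 : Summable fun n => |φ (x n)| := summable_of_sum_le (fun n => abs_nonneg _) h1
  exact (tendsto_zero_iff_abs_tendsto_zero _).2 h2.tendsto_atTop_zero

/-- If every sequence dominated by `y` is weakly null, then the moduli of an `L`-sequence
converge to zero uniformly on `y`. -/
theorem IsLSequence.tendsto_abs_apply {f : ℕ → StrongDual ℝ E} (hf : IsLSequence f) {y : ℕ → E}
    (hy0 : ∀ k, 0 ≤ y k) (hy : ∀ z : ℕ → E, (∀ k, |z k| ≤ y k) → IsWeaklyNull z) (m : ℕ → ℕ) :
    Tendsto (fun k => |f (m k)| (y k)) atTop (𝓝 0) := by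
  have h : ∀ k : ℕ, ∃ z : E, |z| ≤ y k ∧ |f (m k)| (y k) < f (m k) z + 1 / ((k : ℝ) + 1) :=
    fun k => exists_abs_apply_lt _ (hy0 k) Nat.one_div_pos_of_nat
  choose z hz hlt using h
  have h1 := hf.tendsto_apply (hy z hz) m
  have h2 := h1.add (tendsto_one_div_add_atTop_nhds_zero_nat (𝕜 := ℝ))
  rw [add_zero] at h2
  exact tendsto_of_tendsto_of_tendsto_of_le_of_le tendsto_const_nhds h2
    (fun k => apply_nonneg (abs_nonneg _) (hy0 k)) fun k => (hlt k).le

end NullLattice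

/-- This is Banach-Alaoglu. Ultrafilters replace subsequences because dual balls need not be weak*
sequentially compact. -/
theorem exists_ultrafilter_limit {X ι : Type*} [NormedAddCommGroup X] [NormedSpace ℝ X]
    (U : Ultrafilter ι) {g : ι → StrongDual ℝ X} {C : ℝ} (hC : ∀ i, ‖g i‖ ≤ C) :
    ∃ l : StrongDual ℝ X, ‖l‖ ≤ C ∧ ∀ x, Tendsto (fun i => g i x) U (𝓝 (l x)) := by
  obtain ⟨l, hl, h⟩ := (WeakDual.isCompact_closedBall (𝕜 := ℝ) (E := X) 0 C).ultrafilter_le_nhds'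
    (U.map fun i => StrongDual.toWeakDual (g i)) (by
      refine Filter.Eventually.of_forall (f := (U : Filter ι)) fun i => ?_
      have : g i ∈ Metric.closedBall (0 : StrongDual ℝ X) C := by simpa using hC i
      exact this)
  refine ⟨WeakDual.toStrongDual l, ?_, fun x => ?_⟩
  · have h1 : WeakDual.toStrongDual l ∈ Metric.closedBall (0 : StrongDual ℝ X) C := hl
    simpa using h1
  · exact ((WeakDual.eval_continuous x).tendsto l).comp h

theorem sum_half_pow_le_two (s : Finset ℕ) : ∑ i ∈ s, (1 / 2 : ℝ) ^ i ≤ 2 :=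
  (summable_geometric_two.sum_le_tsum s fun i _ => by positivity).trans tsum_geometric_two.le

/-! ### Disjointification in a Banach lattice and its dual -/

section EquiIntegrability

variable {E : Type*} [NormedAddCommGroup E] [Lattice E] [IsOrderedAddMonoid E] [HasSolidNorm E]
  [NormedSpace ℝ E] [IsOrderedModule ℝ E]

omit [NormedSpace ℝ E] [IsOrderedModule ℝ E] [HasSolidNorm E] in
theorem posPart_le_posPart_sub_add (p : E) {q : E} (hq : 0 ≤ q) : p⁺ ≤ (p - q)⁺ + q :=
  sup_le (sub_le_iff_le_add.1 (le_posPart _)) (add_nonneg (posPart_nonneg _) hq)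

/-- Equi-integrability of a set on whose solid hull disjoint sequences are null, uniformly with
respect to a bounded set of positive functionals. -/
theorem exists_forall_apply_posPart_sub_le [CompleteSpace E] {A : Set E}
    {G : Set (StrongDual ℝ E)} {R C : ℝ} (hA : ∀ a ∈ A, ‖a‖ ≤ R) (hG : ∀ g ∈ G, 0 ≤ g)
    (hC : ∀ g ∈ G, ‖g‖ ≤ C)
    (h : ∀ y : ℕ → E, (∀ k, 0 ≤ y k) →
      (∀ k, y k ∈ LatticeOrderedAddCommGroup.solidClosure A) → IsDisjointSeq y →
      ∀ g : ℕ → StrongDual ℝ E, (∀ k, g k ∈ G) → Tendsto (fun k => g k (y k)) atTop (𝓝 0))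
    {ε : ℝ} (hε : 0 < ε) : ∃ u : E, 0 ≤ u ∧ ∀ a ∈ A, ∀ g ∈ G, g (|a| - u)⁺ ≤ ε := by
  by_contra hcon
  push Not at hcon
  choose! a ha g hg hlt using hcon
  -- `S n` is the sum of the moduli already chosen; the next element is a counterexample to `4 ^ n •
  -- S n` being an admissible bound.
  let S : ℕ → E := fun n => Nat.rec 0 (fun n s => s + |a ((4 : ℝ) ^ n • s)|) n
  let x : ℕ → E := fun n => |a ((4 : ℝ) ^ n • S n)|
  have hx0 : ∀ n, 0 ≤ x n := fun n => abs_nonneg _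
  have hS : ∀ n, S n = ∑ i ∈ Finset.range n, x i := by
    intro n
    induction n with
    | zero => simp [S]
    | succ n ih =>
      rw [Finset.sum_range_succ, ← ih]
  have hS0 : ∀ n, 0 ≤ (4 : ℝ) ^ n • S n := fun n =>
    smul_nonneg (by positivity) (by rw [hS]; exact Finset.sum_nonneg fun i _ => hx0 i)
  have hsum : Summable fun n => (1 / 2 : ℝ) ^ n • x n := by
    refine Summable.of_norm_bounded (summable_geometric_two.mul_right R) fun n => ?_
    rw [norm_smul, norm_abs_eq_norm, Real.norm_of_nonneg (by positivity)]
    exact mul_le_mul_of_nonneg_left (hA _ (ha _ (hS0 n))) (by positivity)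
  have hpos : ∀ n, 0 ≤ (1 / 2 : ℝ) ^ n • x n := fun n => smul_nonneg (by positivity) (hx0 n)
  let w : E := ∑' n, (1 / 2 : ℝ) ^ n • x n
  have hw : 0 ≤ w := tsum_nonneg hpos
  have hxw : ∀ n, x n ≤ (2 : ℝ) ^ n • w := by
    intro n
    have h1 : (1 / 2 : ℝ) ^ n • x n ≤ w := hsum.le_tsum n fun i _ => hpos i
    have h2 := smul_le_smul_of_nonneg_left h1 (pow_nonneg zero_le_two n : (0 : ℝ) ≤ 2 ^ n)
    rwa [smul_smul, ← mul_pow, mul_one_div_cancel two_ne_zero, one_pow, one_smul] at h2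
  -- The required inequality is `2 ^ n ≤ 4 ^ n * (1 / 2) ^ i` for `i < n`, and `θ n → 0` makes the
  -- subtracted multiple of `w` harmless.
  have hdis := disjointify (M := fun n => 2 ^ n) (K := fun n => 4 ^ n) (θ := fun n => (1 / 2) ^ n)
    hx0 (fun n => by positivity) (fun n => by positivity) (fun n => by positivity) hxw (by
      intro i n hin
      have h1 : (4 : ℝ) ^ n = 2 ^ n * 2 ^ n := by rw [← mul_pow]; norm_num
      have h2 : (2 : ℝ) ^ i ≤ 2 ^ n := pow_le_pow_right₀ one_le_two hin.le
      have h3 : (2 : ℝ) ^ i * (1 / 2) ^ i = 1 := by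
        rw [← mul_pow, mul_one_div_cancel two_ne_zero, one_pow]
      calc (2 : ℝ) ^ n = 2 ^ n * (2 ^ i * (1 / 2) ^ i) := by rw [h3, mul_one]
        _ = 2 ^ n * 2 ^ i * (1 / 2) ^ i := by ring
        _ ≤ 2 ^ n * 2 ^ n * (1 / 2) ^ i := by gcongr
        _ = _ := by rw [h1])
  have hlim := h _ (fun n => posPart_nonneg _) (fun n => ?_) hdis
    (fun n => g ((4 : ℝ) ^ n • S n)) fun n => hg _ (hS0 n)
  · have h4 : ∀ n, ε ≤ g ((4 : ℝ) ^ n • S n) (x n - (4 : ℝ) ^ n • ∑ i ∈ Finset.range n, x i -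
        (1 / 2 : ℝ) ^ n • w)⁺ + (1 / 2 : ℝ) ^ n * (C * ‖w‖) := by
      intro n
      have h5 := hG _ (hg _ (hS0 n))
      have h6 := hlt _ (hS0 n)
      have h7 := apply_mono h5 (posPart_le_posPart_sub_add
        (x n - (4 : ℝ) ^ n • ∑ i ∈ Finset.range n, x i)
        (smul_nonneg (by positivity : (0 : ℝ) ≤ (1 / 2) ^ n) hw))
      rw [map_add, map_smul, smul_eq_mul] at h7
      have h8 : g ((4 : ℝ) ^ n • S n) w ≤ C * ‖w‖ :=
        ((le_abs_self _).trans ((g ((4 : ℝ) ^ n • S n)).le_opNorm w)).trans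
          (mul_le_mul_of_nonneg_right (hC _ (hg _ (hS0 n))) (norm_nonneg w))
      have h9 : (1 / 2 : ℝ) ^ n * g ((4 : ℝ) ^ n • S n) w ≤ (1 / 2 : ℝ) ^ n * (C * ‖w‖) :=
        mul_le_mul_of_nonneg_left h8 (by positivity)
      rw [← hS n] at h7 ⊢
      exact h6.le.trans (h7.trans (by gcongr))
    have h5 := hlim.add ((tendsto_pow_atTop_nhds_zero_of_lt_one (r := (1 / 2 : ℝ)) (by norm_num)
      (by norm_num)).mul_const (C * ‖w‖))
    rw [zero_mul, add_zero] at h5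
    exact absurd (ge_of_tendsto' h5 h4) (not_le.2 hε)
  · refine ⟨_, ha _ (hS0 n), ?_⟩
    rw [abs_of_nonneg (posPart_nonneg _)]
    refine sup_le ?_ (hx0 n)
    refine (sub_le_self _ (smul_nonneg (by positivity) hw)).trans (sub_le_self _ ?_)
    rw [← hS]
    exact hS0 n

omit [IsOrderedModule ℝ E] in
/-- For disjoint positive functionals, elements of `[0, u]` almost carrying `g n` and almost
annihilated by the preceding functionals. -/
theorem exists_almost_carrier {g : ℕ → StrongDual ℝ E} (hg0 : ∀ n, 0 ≤ g n)
    (hd : IsDisjointSeq g) {u : E} (hu : 0 ≤ u) {η : ℝ} (hη : 0 < η) (n : ℕ) :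
    ∃ v, 0 ≤ v ∧ v ≤ u ∧ g n u - η ≤ g n v ∧ ∀ m < n, g m v ≤ η * (1 / 2) ^ n := by
  have hdis : g n ⊓ ∑ m ∈ Finset.range n, g m = 0 := by
    rw [inf_comm]
    refine sum_inf_eq_zero hg0 (hg0 n) _ fun m hm => ?_
    have := hd m n (Finset.mem_range.1 hm).ne
    rwa [abs_of_nonneg (hg0 m), abs_of_nonneg (hg0 n)] at this
  have hη' : 0 < η * (1 / 2) ^ n := by positivity
  -- The infimum of `g n` and the sum of its predecessors vanishes, so some `v` makes both `g n (u -
  -- v)` and that sum at `v` small.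
  obtain ⟨v, hv0, hvu, hv⟩ := exists_inf_apply_lt (g n) (∑ m ∈ Finset.range n, g m) hu hη'
  rw [hdis, map_sub, sum_apply, zero_apply, zero_add] at hv
  have h1 : ∀ m, 0 ≤ g m v := fun m => apply_nonneg (hg0 m) hv0
  have h2 : 0 ≤ ∑ m ∈ Finset.range n, g m v := Finset.sum_nonneg fun m _ => h1 m
  have h3 : η * (1 / 2) ^ n ≤ η :=
    mul_le_of_le_one_right hη.le (pow_le_one₀ (by norm_num) (by norm_num))
  refine ⟨v, hv0, hvu, by linarith, fun m hm => ?_⟩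
  have h4 : g m v ≤ ∑ m ∈ Finset.range n, g m v :=
    Finset.single_le_sum (fun i _ => h1 i) (Finset.mem_range.2 hm)
  have h5 := apply_mono (hg0 n) hvu
  linarith

/-- Disjoint positive functionals bounded away from zero at `u` are bounded away from zero on a
disjoint sequence in `[0, u]`, after passing to a subfamily. -/
theorem exists_disjointSeq_of_disjointSeq_dual {g : ℕ → StrongDual ℝ E} (hg0 : ∀ n, 0 ≤ g n)
    (hd : IsDisjointSeq g) {B : ℝ} (hB : ∀ n, ‖g n‖ ≤ B) {u : E} (hu : 0 ≤ u) {ε : ℝ}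
    (hε : 0 < ε) (hgu : ∀ n, ε ≤ g n u) :
    ∃ (y : ℕ → E) (m : ℕ → ℕ), (∀ k, 0 ≤ y k) ∧ (∀ k, y k ≤ u) ∧ IsDisjointSeq y ∧
      ∀ k, ε / 4 ≤ g (m k) (y k) := by
  have hB0 : 0 ≤ B := (norm_nonneg _).trans (hB 0)
  obtain ⟨C, hC0, hC⟩ : ∃ C : ℝ, 0 < C ∧ ∀ n, g n u ≤ C := by
    refine ⟨B * ‖u‖ + 1, by positivity, fun n => ?_⟩
    have h1 := (le_abs_self _).trans ((g n).le_opNorm u)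
    have h2 := mul_le_mul_of_nonneg_right (hB n) (norm_nonneg u)
    linarith
  -- `K` makes the loss from `K⁻¹ • u` small, and then `η` is chosen so that the loss from `K` times
  -- the later carriers is small too.
  obtain ⟨K, hK0, hK⟩ : ∃ K : ℝ, 0 < K ∧ ∀ n, K⁻¹ * g n u ≤ ε / 8 := by
    refine ⟨8 * C / ε, by positivity, fun n => ?_⟩
    calc (8 * C / ε)⁻¹ * g n u ≤ (8 * C / ε)⁻¹ * C := by gcongr; exact hC n
      _ = ε / 8 := by field_simp
  obtain ⟨η, hη0, hη⟩ : ∃ η : ℝ, 0 < η ∧ η + K * (η * 2) ≤ ε / 8 := by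
    refine ⟨ε / 8 / (1 + 2 * K), by positivity, le_of_eq ?_⟩
    field_simp
  choose e he0 heu hge hlt using exists_almost_carrier hg0 hd hu hη0
  have hKu : 0 ≤ K⁻¹ • u := smul_nonneg (inv_nonneg.2 hK0.le) hu
  -- Later carriers are subtracted because `g m` is small on `e i` only for `i > m`. The result is
  -- disjoint only up to the cutoff `N`.
  let v : ℕ → ℕ → E := fun m N => (e m - K • ∑ i ∈ Finset.Ioc m N, e i - K⁻¹ • u)⁺
  have hs0 : ∀ s : Finset ℕ, 0 ≤ K • ∑ i ∈ s, e i := fun s =>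
    smul_nonneg hK0.le (Finset.sum_nonneg fun i _ => he0 i)
  have hv0 : ∀ m N, 0 ≤ v m N := fun m N => posPart_nonneg _
  have hve : ∀ m N, v m N ≤ e m := fun m N =>
    sup_le ((sub_le_self _ hKu).trans (sub_le_self _ (hs0 _))) (he0 m)
  have hvu : ∀ m N, v m N ≤ u := fun m N => (hve m N).trans (heu m)
  have hvd : ∀ N m m', m < m' → m' ≤ N → v m N ⊓ v m' N = 0 := by
    intro N m m' hmm hN
    refine inf_eq_zero_of_le_posPart_sub hK0 (hv0 _ _) (hv0 _ _) (a := e m) (b := e m')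
      (posPart_mono ?_) (posPart_mono ?_)
    · have h1 : e m' ≤ ∑ i ∈ Finset.Ioc m N, e i :=
        Finset.single_le_sum (fun i _ => he0 i) (Finset.mem_Ioc.2 ⟨hmm, hN⟩)
      exact (sub_le_self _ hKu).trans
        (sub_le_sub_left (smul_le_smul_of_nonneg_left h1 hK0.le) _)
    · exact (sub_le_sub_right (sub_le_self _ (hs0 _)) _).trans
        (sub_le_sub_left (smul_le_smul_of_nonneg_left (heu m) (inv_nonneg.2 hK0.le)) _)
  have hgv : ∀ m N, ε / 2 ≤ g m (v m N) := by
    intro m N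
    have h1 := apply_mono (hg0 m) (le_posPart (e m - K • ∑ i ∈ Finset.Ioc m N, e i - K⁻¹ • u))
    rw [map_sub, map_sub, map_smul, map_smul, map_sum, smul_eq_mul, smul_eq_mul] at h1
    have h2 : ∑ i ∈ Finset.Ioc m N, g m (e i) ≤ η * 2 := calc
      _ ≤ ∑ i ∈ Finset.Ioc m N, η * (1 / 2) ^ i :=
          Finset.sum_le_sum fun i hi => hlt i m (Finset.mem_Ioc.1 hi).1
      _ = η * ∑ i ∈ Finset.Ioc m N, (1 / 2) ^ i := by rw [Finset.mul_sum]
      _ ≤ η * 2 := mul_le_mul_of_nonneg_left (sum_half_pow_le_two _) hη0.le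
    have h3 := mul_le_mul_of_nonneg_left h2 hK0.le
    have h4 := hK m
    have h5 := hge m
    have h6 := hgu m
    change _ ≤ g m (v m N) at h1
    linarith
  -- Nothing yet controls `g n` on earlier elements. If the limit functional `l` is small on an
  -- element, so is `g n` for almost all `n`.
  obtain ⟨l, -, hl⟩ := exists_ultrafilter_limit (hyperfilter ℕ) hB
  have hl0 : 0 ≤ l := fun x hx => ge_of_tendsto' (hl x) fun n => apply_nonneg (hg0 n) hx
  -- For a fixed cutoff the `v m N` are disjoint in `[0, u]`, so fewer than `l u / δ + 1` of them
  -- can satisfy `δ ≤ l (v m N)`.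
  have hsmall : ∀ δ : ℝ, 0 < δ → ∀ᶠ m in hyperfilter ℕ, ∃ N, l (v m N) < δ := by
    intro δ hδ
    by_contra hcon
    have hinf : {m | ∀ N, δ ≤ l (v m N)}.Infinite := by
      intro hfin
      refine hcon (mem_of_superset (hyperfilter_le_cofinite hfin.compl_mem_cofinite) ?_)
      intro m hm
      simp only [Set.mem_compl_iff, Set.mem_ofPred_eq, not_forall, not_le] at hm
      exact hm
    obtain ⟨k, hk⟩ := exists_nat_gt (l u / δ)
    obtain ⟨s, hs, hsk⟩ := hinf.exists_subset_card_eq k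
    obtain ⟨N, hN⟩ : ∃ N, ∀ m ∈ s, m ≤ N := ⟨s.sup id, fun m hm => Finset.le_sup (f := id) hm⟩
    have h1 : ∑ m ∈ s, v m N ≤ u := by
      refine sum_le_of_disjoint hu (fun m => hv0 m N) s (fun m _ => hvu m N) fun i hi j hj hij => ?_
      rcases hij.lt_or_gt with h | h
      · exact hvd N i j h (hN j hj)
      · rw [inf_comm]; exact hvd N j i h (hN i hi)
    have h2 := apply_mono hl0 h1
    rw [map_sum] at h2
    have h3 : (k : ℝ) * δ ≤ ∑ m ∈ s, l (v m N) := by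
      rw [← hsk, ← nsmul_eq_mul]
      exact Finset.card_nsmul_le_sum _ _ _ fun m hm => hs hm N
    rw [div_lt_iff₀ hδ] at hk
    linarith
  obtain ⟨c, hc0, hc⟩ : ∃ c : ℝ, 0 < c ∧ K * (c * 2) ≤ ε / 8 :=
    ⟨ε / 8 / (2 * K), by positivity, le_of_eq (by field_simp)⟩
  -- Entries are (counter, functional index, element). The growing counter makes the errors `c * (1
  -- / 2) ^ j` summable, and each new functional is small on all earlier elements.
  obtain ⟨F, hF, hFr⟩ := exists_seq_of_forall_finset_exists (α := ℕ × ℕ × E)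
    (fun p => 0 ≤ p.2.2 ∧ p.2.2 ≤ u ∧ ε / 2 ≤ g p.2.1 p.2.2 ∧ l p.2.2 < c * (1 / 2) ^ p.1)
    (fun p q => p.1 < q.1 ∧ g q.2.1 p.2.2 < c * (1 / 2) ^ p.1) (by
      intro s hs
      obtain ⟨j, hj⟩ : ∃ j, ∀ p ∈ s, p.1 < j :=
        ⟨s.sup Prod.fst + 1, fun p hp => Nat.lt_succ_of_le (Finset.le_sup (f := Prod.fst) hp)⟩
      have h1 : ∀ᶠ n in hyperfilter ℕ, ∀ p ∈ s, g n p.2.2 < c * (1 / 2) ^ p.1 := by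
        rw [Filter.eventually_all_finset]
        exact fun p hp => (hl _).eventually_lt_const (hs p hp).2.2.2
      obtain ⟨m, hm, N, hN⟩ := (h1.and (hsmall (c * (1 / 2) ^ j) (by positivity))).exists
      exact ⟨(j, m, v m N), ⟨hv0 _ _, hvu _ _, hgv _ _, hN⟩, fun p hp => ⟨hj p hp, hm p hp⟩⟩)
  have hmono : ∀ i, i ≤ (F i).1 :=
    (strictMono_nat_of_lt_succ (f := fun i => (F i).1) fun i => (hFr i (i + 1) i.lt_succ_self).1).id_le
  -- This second disjointification subtracts earlier elements and so no longer depends on a cutoff;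
  -- of `ε / 2` it loses at most `ε / 8` twice.
  have hdis := disjointify (x := fun k => (F k).2.2) (w := u) (M := fun _ => 1)
    (K := fun _ => K) (θ := fun _ => K⁻¹) (fun k => (hF k).1) (fun _ => one_pos) (fun _ => hK0)
    (fun _ => inv_pos.2 hK0) (fun k => by rw [one_smul]; exact (hF k).2.1)
    fun _ _ _ => (mul_inv_cancel₀ hK0.ne').ge
  refine ⟨_, fun k => (F k).2.1, fun k => posPart_nonneg _, fun k => ?_, hdis, fun k => ?_⟩
  · refine sup_le ((sub_le_self _ hKu).trans ((sub_le_self _ ?_).trans (hF k).2.1)) hu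
    exact smul_nonneg hK0.le (Finset.sum_nonneg fun i _ => (hF i).1)
  · have h1 := apply_mono (hg0 (F k).2.1) (le_posPart ((F k).2.2 -
      K • ∑ i ∈ Finset.range k, (F i).2.2 - K⁻¹ • u))
    rw [map_sub, map_sub, map_smul, map_smul, map_sum, smul_eq_mul, smul_eq_mul] at h1
    have h2 : ∑ i ∈ Finset.range k, g (F k).2.1 (F i).2.2 ≤ c * 2 := calc
      _ ≤ ∑ i ∈ Finset.range k, c * (1 / 2) ^ i := by
          refine Finset.sum_le_sum fun i hi => (hFr i k (Finset.mem_range.1 hi)).2.le.trans ?_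
          exact mul_le_mul_of_nonneg_left
            (pow_le_pow_of_le_one (by norm_num) (by norm_num) (hmono i)) hc0.le
      _ = c * ∑ i ∈ Finset.range k, (1 / 2) ^ i := by rw [Finset.mul_sum]
      _ ≤ c * 2 := mul_le_mul_of_nonneg_left (sum_half_pow_le_two _) hc0.le
    have h3 := mul_le_mul_of_nonneg_left h2 hK0.le
    have h4 := hK (F k).2.1
    have h5 := (hF k).2.2.1
    linarith

omit [IsOrderedModule ℝ E] in
theorem norm_abs_dual_le (f : StrongDual ℝ E) : ‖|f|‖ ≤ ‖f‖ := by
  refine ContinuousLinearMap.opNorm_le_bound _ (norm_nonneg f) fun x => ?_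
  refine (apply_abs_le_of_nonneg (abs_nonneg f) le_rfl x).trans ?_
  have := abs_apply_le_opNorm f (abs_nonneg x)
  rwa [norm_abs_eq_norm] at this

/-- The moduli of a disjoint `L`-sequence form a weak* null sequence. -/
theorem IsLSequence.tendsto_abs_apply_of_isDisjointSeq {f : ℕ → StrongDual ℝ E}
    (hf : IsLSequence f) (hd : IsDisjointSeq f) {u : E} (hu : 0 ≤ u) :
    Tendsto (fun n => |f n| u) atTop (𝓝 0) := by
  by_contra hcon
  obtain ⟨ε, hε, hfr⟩ : ∃ ε > 0, ∃ᶠ n in atTop, ε ≤ |f n| u := by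
    rw [Metric.tendsto_nhds] at hcon
    push Not at hcon
    obtain ⟨ε, hε, h⟩ := hcon
    refine ⟨ε, hε, h.mono fun n hn => ?_⟩
    rwa [Real.dist_0_eq_abs, abs_of_nonneg (apply_nonneg (abs_nonneg (f n)) hu)] at hn
  obtain ⟨φ, hφ, hφε⟩ := extraction_of_frequently_atTop hfr
  obtain ⟨B, hB⟩ := hf.exists_norm_le
  obtain ⟨y, m, hy0, hyu, hyd, hy⟩ := exists_disjointSeq_of_disjointSeq_dual
    (g := fun n => |f (φ n)|) (fun n => abs_nonneg _) (hd.comp hφ.injective).abs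
    (fun n => (norm_abs_dual_le _).trans (hB _)) hu hε hφε
  have h1 := hf.tendsto_abs_apply hy0 (fun z hz => (hyd.of_abs_le fun k => by
    rw [abs_of_nonneg (hy0 k)]; exact hz k).isWeaklyNull fun k => (hz k).trans (hyu k))
    (fun k => φ (m k))
  exact absurd (ge_of_tendsto' h1 hy) (not_le.2 (by positivity))

theorem IsLSequence.isWeakStarNull_of_isDisjointSeq {f : ℕ → StrongDual ℝ E}
    (hf : IsLSequence f) (hd : IsDisjointSeq f) : IsWeakStarNull f := by
  rw [isWeakStarNull_iff]
  intro x
  exact squeeze_zero_norm (fun n => abs_apply_le (f n) x)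
    (hf.tendsto_abs_apply_of_isDisjointSeq hd (abs_nonneg x))

end EquiIntegrability

/-! ### Restriction of functionals to bands -/

section BandRestriction

variable {E : Type*} [NormedAddCommGroup E] [Lattice E] [IsOrderedAddMonoid E] [HasSolidNorm E]
  [NormedSpace ℝ E]

theorem tendsto_apply_inf_nsmul {f : StrongDual ℝ E} (hf : 0 ≤ f) {u : E} (hu : 0 ≤ u) (z : E) :
    Tendsto (fun k : ℕ => f (z ⊓ k • u)) atTop (𝓝 (⨆ k : ℕ, f (z ⊓ k • u))) := by
  refine tendsto_atTop_ciSup (fun i j hij => apply_mono hf (inf_le_inf_left z ?_)) ⟨f z, ?_⟩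
  · exact nsmul_le_nsmul_left hu hij
  · rintro _ ⟨k, rfl⟩
    exact apply_mono hf inf_le_left

/-- The restriction of a positive functional to the band generated by `u ≥ 0`, given by
`z ↦ sup_k f (z ⊓ k u)` for `z ≥ 0`. -/
def bandRestrict (f : StrongDual ℝ E) (hf : 0 ≤ f) (u : E) (hu : 0 ≤ u) : StrongDual ℝ E :=
  ofPosAdditive f (fun z => ⨆ k : ℕ, f (z ⊓ k • u))
    (fun x hx => ge_of_tendsto' (tendsto_apply_inf_nsmul hf hu x) fun k =>
      apply_nonneg hf (le_inf hx (nsmul_nonneg hu k)))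
    (fun x _ => le_of_tendsto' (tendsto_apply_inf_nsmul hf hu x) fun k =>
      apply_mono hf inf_le_left)
    (fun x y hx hy => by
      have hxt := tendsto_apply_inf_nsmul hf hu x
      have hyt := tendsto_apply_inf_nsmul hf hu y
      have hxy := tendsto_apply_inf_nsmul hf hu (x + y)
      apply le_antisymm
      · refine le_of_tendsto_of_tendsto' hxy (hxt.add hyt) fun k => ?_
        rw [← map_add]
        exact apply_mono hf (add_inf_le_inf_add_inf hx hy (nsmul_nonneg hu k))
      -- Superadditivity needs the doubled index: the sum of the truncations of `x` and `y` at `k •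
      -- u` lies below the truncation of `x + y` at `(2 * k) • u`.
      · have h2 : Tendsto (fun k : ℕ => 2 * k) atTop atTop :=
          tendsto_id.const_mul_atTop' two_pos
        refine le_of_tendsto_of_tendsto' (hxt.add hyt) (hxy.comp h2) fun k => ?_
        rw [← map_add]
        refine apply_mono hf (le_inf (add_le_add inf_le_left inf_le_left) ?_)
        change _ ≤ (2 * k) • u
        rw [two_mul, add_nsmul]
        exact add_le_add inf_le_right inf_le_right)

variable {f g : StrongDual ℝ E} {hf : 0 ≤ f} {hg : 0 ≤ g} {u v : E} {hu : 0 ≤ u} {hv : 0 ≤ v}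

theorem bandRestrict_tendsto {z : E} (hz : 0 ≤ z) :
    Tendsto (fun k : ℕ => f (z ⊓ k • u)) atTop (𝓝 (bandRestrict f hf u hu z)) := by
  rw [bandRestrict, ofPosAdditive_apply _ _ _ hz]
  exact tendsto_apply_inf_nsmul hf hu z

theorem bandRestrict_nonneg : 0 ≤ bandRestrict f hf u hu := fun _ hz =>
  ge_of_tendsto' (bandRestrict_tendsto hz) fun k => apply_nonneg hf (le_inf hz (nsmul_nonneg hu k))

theorem bandRestrict_le : bandRestrict f hf u hu ≤ f := fun _ hz =>
  le_of_tendsto' (bandRestrict_tendsto hz) fun _ => apply_mono hf inf_le_left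

theorem bandRestrict_apply_of_le {z : E} (hz : 0 ≤ z) {k : ℕ} (hzu : z ≤ k • u) :
    bandRestrict f hf u hu z = f z := by
  refine tendsto_nhds_unique (bandRestrict_tendsto hz) (tendsto_const_nhds.congr' ?_)
  filter_upwards [eventually_ge_atTop k] with j hj
  rw [inf_eq_left.2 (hzu.trans (nsmul_le_nsmul_left hu hj))]

theorem bandRestrict_apply_of_inf_eq_zero {z : E} (hz : 0 ≤ z) (hzu : z ⊓ u = 0) :
    bandRestrict f hf u hu z = 0 := by
  refine tendsto_nhds_unique (bandRestrict_tendsto hz) (tendsto_const_nhds.congr fun k => ?_)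
  have h := sum_inf_eq_zero (x := fun _ : ℕ => u) (c := z) (fun _ => hu) hz (Finset.range k)
    fun _ _ => by rw [inf_comm]; exact hzu
  rw [Finset.sum_const, Finset.card_range, inf_comm] at h
  rw [h, map_zero]

/-- The truncations `z ⊓ k • u` asymptotically carry the first restriction, while the second
vanishes on them because they are disjoint from `v`. -/
theorem bandRestrict_inf_bandRestrict (huv : u ⊓ v = 0) :
    bandRestrict f hf u hu ⊓ bandRestrict g hg v hv = 0 := by
  refine inf_eq_zero_of_forall bandRestrict_nonneg bandRestrict_nonneg fun z hz => ?_
  set h := bandRestrict f hf u hu ⊓ bandRestrict g hg v hv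
  have hlim : Tendsto (fun k : ℕ => bandRestrict f hf u hu z - f (z ⊓ k • u)) atTop (𝓝 0) := by
    simpa using (bandRestrict_tendsto (f := f) (hf := hf) (u := u) (hu := hu) hz).const_sub
      (bandRestrict f hf u hu z)
  refine ge_of_tendsto' hlim fun k => ?_
  have hk0 : 0 ≤ z ⊓ k • u := le_inf hz (nsmul_nonneg hu k)
  have h1 : h (z ⊓ k • u) ≤ 0 := by
    have h2 : h (z ⊓ k • u) ≤ bandRestrict g hg v hv (z ⊓ k • u) :=
      (inf_le_right : h ≤ bandRestrict g hg v hv) _ hk0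
    rwa [bandRestrict_apply_of_inf_eq_zero hk0] at h2
    have h3 := sum_inf_eq_zero (x := fun _ : ℕ => u) (c := v) (fun _ => hu) hv (Finset.range k)
      fun _ _ => huv
    rw [Finset.sum_const, Finset.card_range] at h3
    exact inf_eq_zero_of_le hk0 hv inf_le_right le_rfl h3
  have h2 : h (z - z ⊓ k • u) ≤ bandRestrict f hf u hu (z - z ⊓ k • u) :=
    (inf_le_left : h ≤ bandRestrict f hf u hu) _ (sub_nonneg.2 inf_le_left)
  rw [map_sub, map_sub, bandRestrict_apply_of_le hk0 inf_le_right] at h2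
  linarith

/-- A positive functional `g` has a signed companion `h`, `|h| ≤ g`, with `h a = g |a|`. -/
theorem exists_abs_le_apply_eq_apply_abs (hg : 0 ≤ g) (a : E) :
    ∃ h : StrongDual ℝ E, |h| ≤ g ∧ h a = g |a| := by
  let p := bandRestrict g hg a⁺ (posPart_nonneg a)
  let q := bandRestrict g hg a⁻ (negPart_nonneg a)
  refine ⟨p - q, abs_le_of_forall fun x hx => ?_, ?_⟩
  · have h1 : 0 ≤ p x := bandRestrict_nonneg x hx
    have h2 : 0 ≤ q x := bandRestrict_nonneg x hx
    have h3 : p x ≤ g x := bandRestrict_le x hx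
    have h4 : q x ≤ g x := bandRestrict_le x hx
    change |p x - q x| ≤ g x
    rw [abs_le]
    constructor <;> linarith
  · have h1 : p a⁺ = g a⁺ := bandRestrict_apply_of_le (k := 1) (posPart_nonneg a) (one_nsmul _).ge
    have h2 : q a⁻ = g a⁻ := bandRestrict_apply_of_le (k := 1) (negPart_nonneg a) (one_nsmul _).ge
    have h3 : p a⁻ = 0 := bandRestrict_apply_of_inf_eq_zero (negPart_nonneg a)
      (by rw [inf_comm]; exact posPart_inf_negPart_eq_zero a)
    have h4 : q a⁺ = 0 := bandRestrict_apply_of_inf_eq_zero (posPart_nonneg a)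
      (posPart_inf_negPart_eq_zero a)
    have h5 : ∀ L : StrongDual ℝ E, L a = L a⁺ - L a⁻ := fun L => by
      rw [← map_sub, posPart_sub_negPart]
    rw [← posPart_add_negPart, map_add]
    change p a - q a = _
    rw [h5 p, h5 q, h1, h2, h3, h4]
    ring

end BandRestriction

/-! ### Order bounded disjoint sequences in the dual -/

section OrderBoundedDisjoint

variable {E : Type*} [NormedAddCommGroup E] [Lattice E] [IsOrderedAddMonoid E] [HasSolidNorm E]
  [NormedSpace ℝ E]

theorem sum_dual_le_of_isDisjointSeq {g : ℕ → StrongDual ℝ E} {f : StrongDual ℝ E}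
    (hg0 : ∀ n, 0 ≤ g n) (hd : IsDisjointSeq g) (hgf : ∀ n, g n ≤ f) (s : Finset ℕ) :
    ∑ n ∈ s, g n ≤ f :=
  sum_le_of_disjoint ((hg0 0).trans (hgf 0)) hg0 s (fun n _ => hgf n) fun m _ n _ hmn => by
    have := hd m n hmn
    rwa [abs_of_nonneg (hg0 m), abs_of_nonneg (hg0 n)] at this

theorem sum_abs_apply_le {g : ℕ → StrongDual ℝ E} {f : StrongDual ℝ E} (hg0 : ∀ n, 0 ≤ g n)
    (hs : ∀ s : Finset ℕ, ∑ n ∈ s, g n ≤ f) (s : Finset ℕ) (x : E) :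
    ∑ n ∈ s, |g n x| ≤ f |x| := calc
  ∑ n ∈ s, |g n x| ≤ ∑ n ∈ s, g n |x| :=
      Finset.sum_le_sum fun n _ => apply_abs_le_of_nonneg (hg0 n) le_rfl x
  _ = (∑ n ∈ s, g n) |x| := by rw [sum_apply]
  _ ≤ f |x| := hs s _ (abs_nonneg x)

theorem summable_abs_apply {g : ℕ → StrongDual ℝ E} {f : StrongDual ℝ E} (hg0 : ∀ n, 0 ≤ g n)
    (hs : ∀ s : Finset ℕ, ∑ n ∈ s, g n ≤ f) (x : E) : Summable fun n => |g n x| :=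
  summable_of_sum_le (fun _ => abs_nonneg _) fun s => sum_abs_apply_le hg0 hs s x

/-- The pointwise sum of a family of positive functionals with bounded partial sums. -/
theorem exists_dual_eq_tsum_indicator {g : ℕ → StrongDual ℝ E} {f : StrongDual ℝ E}
    (hg0 : ∀ n, 0 ≤ g n) (hs : ∀ s : Finset ℕ, ∑ n ∈ s, g n ≤ f) (a : Set ℕ) :
    ∃ F : StrongDual ℝ E, ∀ x, F x = ∑' n, a.indicator (fun n => g n x) n := by
  have hsum : ∀ x, Summable (a.indicator fun n => g n x) := fun x =>
    (summable_abs_apply hg0 hs x).of_abs.indicator a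
  refine ⟨LinearMap.mkContinuous
    { toFun := fun x => ∑' n, a.indicator (fun n => g n x) n
      map_add' := fun x y => ?_
      map_smul' := fun c x => ?_ } ‖f‖ fun x => ?_, fun x => rfl⟩
  · rw [← (hsum x).tsum_add (hsum y)]
    refine tsum_congr fun n => ?_
    by_cases hn : n ∈ a <;> simp [hn]
  · rw [RingHom.id_apply, smul_eq_mul, ← tsum_mul_left]
    refine tsum_congr fun n => ?_
    by_cases hn : n ∈ a <;> simp [hn]
  · have h1 : ∀ s : Finset ℕ, ‖∑ n ∈ s, a.indicator (fun n => g n x) n‖ ≤ ‖f‖ * ‖x‖ := by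
      intro s
      refine (norm_sum_le _ _).trans ((Finset.sum_le_sum fun n _ =>
        norm_indicator_le_norm_self _ n).trans ((sum_abs_apply_le hg0 hs s x).trans ?_))
      have := (le_abs_self _).trans (f.le_opNorm |x|)
      rwa [norm_abs_eq_norm] at this
    exact le_of_tendsto' (hsum x).hasSum.norm h1

/-- Order bounded disjoint sequences in the dual are `L`-sequences. -/
theorem isLSequence_of_isDisjointSeq {g : ℕ → StrongDual ℝ E} {f : StrongDual ℝ E}
    (hg0 : ∀ n, 0 ≤ g n) (hd : IsDisjointSeq g) (hgf : ∀ n, g n ≤ f) : IsLSequence g := by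
  have hs := sum_dual_le_of_isDisjointSeq hg0 hd hgf
  constructor
  · rw [isBounded_iff_forall_norm_le]
    refine ⟨‖f‖, ?_⟩
    rintro _ ⟨n, rfl⟩
    exact norm_le_of_abs_apply_le_apply_abs fun x => apply_abs_le_of_nonneg (hg0 n) (hgf n) x
  · intro x hx
    rw [isWeaklyNull_iff] at hx
    rw [Metric.tendstoUniformlyOn_iff]
    intro ε hε
    -- Every subset sum of the `g n` is itself a bounded functional, so it tends to zero along the
    -- weakly null `x`.
    have h := tendsto_zero_uniformly_of_tsum_indicator (b := fun k n => g n (x k))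
      (fun k => (summable_abs_apply hg0 hs (x k)).of_abs) (fun a => by
        obtain ⟨F, hF⟩ := exists_dual_eq_tsum_indicator hg0 hs a
        exact (hx F).congr fun k => hF _) (half_pos hε)
    filter_upwards [h] with k hk
    rintro _ ⟨n, rfl⟩
    rw [dist_comm, Real.dist_0_eq_abs]
    exact (hk n).trans_lt (half_lt_self hε)

end OrderBoundedDisjoint

/-! ### From functionals on order bounded disjoint sequences back to the operator. -/

section Operator

variable {X E : Type*} [NormedAddCommGroup X] [NormedSpace ℝ X]
  [NormedAddCommGroup E] [Lattice E] [IsOrderedAddMonoid E] [HasSolidNorm E] [NormedSpace ℝ E]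

theorem abs_apply_le_norm_dualOperator (T : X →L[ℝ] E) (f : StrongDual ℝ E) {b : X}
    (hb : ‖b‖ ≤ 1) : |f (T b)| ≤ ‖dualOperator T f‖ :=
  (dualOperator T f).unit_le_opNorm b hb

/-- Reduction from order bounded disjoint sequences to disjoint sequences in `[0, f]`. -/
theorem tendsto_norm_of_forall_nonneg {T : X →L[ℝ] E}
    (H : ∀ (f : StrongDual ℝ E) (g : ℕ → StrongDual ℝ E), (∀ n, 0 ≤ g n) → (∀ n, g n ≤ f) →
      IsDisjointSeq g → Tendsto (fun n => ‖dualOperator T (g n)‖) atTop (𝓝 0))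
    (f : ℕ → StrongDual ℝ E) (hb : IsOrderBoundedSeq f) (hd : IsDisjointSeq f) :
    Tendsto (fun n => ‖dualOperator T (f n)‖) atTop (𝓝 0) := by
  obtain ⟨a, b, hab⟩ := hb
  have hc : ∀ n, |f n| ≤ |a| ⊔ |b| := fun n => abs_le'.2
    ⟨((hab n).2.trans (le_abs_self b)).trans le_sup_right,
      ((neg_le_neg (hab n).1).trans (neg_le_abs a)).trans le_sup_left⟩
  have h1 := H _ _ (fun n => posPart_nonneg (f n)) (fun n => (posPart_le_abs _).trans (hc n))
    hd.posPart
  have h2 := H _ _ (fun n => negPart_nonneg (f n)) (fun n => (negPart_le_abs _).trans (hc n))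
    hd.negPart
  have h3 := h1.add h2
  rw [add_zero] at h3
  refine squeeze_zero (fun n => norm_nonneg _) (fun n => ?_) h3
  calc ‖dualOperator T (f n)‖ = ‖dualOperator T (f n)⁺ - dualOperator T (f n)⁻‖ := by
        rw [← map_sub, posPart_sub_negPart]
    _ ≤ _ := norm_sub_le _ _

/-- Restricting `|φ|` to the bands of disjoint `|x n|` gives disjoint functionals in `[0, |φ|]`.
Companions `h n` with `h n (T (b n)) = g n |T (b n)|` turn the bound on moduli into one by the norms
of the adjoint images. -/
theorem isDisjointlyWeaklyCompactOperator_of_orderBounded {T : X →L[ℝ] E}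
    (H : ∀ f : ℕ → StrongDual ℝ E, IsOrderBoundedSeq f → IsDisjointSeq f →
      Tendsto (fun n => ‖dualOperator T (f n)‖) atTop (𝓝 0)) :
    IsDisjointlyWeaklyCompactOperator T := by
  constructor
  · rw [isBounded_iff_forall_norm_le]
    refine ⟨‖T‖, ?_⟩
    rintro _ ⟨b, hb, rfl⟩
    exact T.unit_le_opNorm b (by simpa using hb)
  · intro x hx hd
    rw [isWeaklyNull_iff]
    intro φ
    have hx' : ∀ n, ∃ b : X, ‖b‖ ≤ 1 ∧ |x n| ≤ |T b| := by
      intro n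
      obtain ⟨_, ⟨b, hb, rfl⟩, h⟩ := hx n
      exact ⟨b, by simpa using hb, h⟩
    choose b hb hxb using hx'
    let g : ℕ → StrongDual ℝ E := fun n => bandRestrict |φ| (abs_nonneg φ) |x n| (abs_nonneg _)
    have hg0 : ∀ n, 0 ≤ g n := fun n => bandRestrict_nonneg
    choose h hh hha using fun n => exists_abs_le_apply_eq_apply_abs (hg0 n) (T (b n))
    have hgd : IsDisjointSeq h := fun m n hmn =>
      inf_eq_zero_of_le (abs_nonneg _) (abs_nonneg _) (hh m) (hh n)
        (bandRestrict_inf_bandRestrict (hd m n hmn))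
    have hlim := H h ⟨-|φ|, |φ|, fun n => by
      have h1 := (hh n).trans (bandRestrict_le : g n ≤ |φ|)
      exact ⟨neg_le.1 ((neg_le_abs _).trans h1), (le_abs_self _).trans h1⟩⟩ hgd
    refine squeeze_zero_norm (fun n => ?_) hlim
    calc ‖φ (x n)‖ ≤ |φ| |x n| := abs_apply_le φ _
      _ = g n |x n| := (bandRestrict_apply_of_le (k := 1) (abs_nonneg _) (one_nsmul _).ge).symm
      _ ≤ g n |T (b n)| := apply_mono (hg0 n) (hxb n)
      _ = h n (T (b n)) := (hha n).symm
      _ ≤ |h n (T (b n))| := le_abs_self _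
      _ ≤ _ := abs_apply_le_norm_dualOperator T _ (hb n)

end Operator

/-! ### Order weak compactness implies norm convergence on disjoint sequences -/

section OrderWeaklyCompact

variable {X E : Type*} [NormedAddCommGroup X] [NormedSpace ℝ X]
  [NormedAddCommGroup E] [Lattice E] [IsOrderedAddMonoid E] [HasSolidNorm E] [NormedSpace ℝ E]

/-- Pointwise convergence inside `[0, f]` passes to functionals of `X''`: by relative weak
compactness the images have a weak limit along an ultrafilter, and evaluation at points of `X`
identifies it. -/
theorem IsOrderWeaklyCompactOperator.bidual_apply_eq {T : X →L[ℝ] E}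
    (hT : IsOrderWeaklyCompactOperator (dualOperator T)) {f F : StrongDual ℝ E}
    {s : ℕ → StrongDual ℝ E} (hs0 : ∀ n, 0 ≤ s n) (hsf : ∀ n, s n ≤ f)
    (hF : ∀ x, Tendsto (fun n => s n x) atTop (𝓝 (F x)))
    (L : StrongDual ℝ (StrongDual ℝ X)) {c : ℝ}
    (hc : Tendsto (fun n => L (dualOperator T (s n))) atTop (𝓝 c)) :
    L (dualOperator T F) = c := by
  have hat : (hyperfilter ℕ : Filter ℕ) ≤ atTop := Nat.hyperfilter_le_atTop
  obtain ⟨ξ, -, hξ⟩ := (hT f ((hs0 0).trans (hsf 0))).ultrafilter_le_nhds'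
    ((hyperfilter ℕ).map fun n => toWeakSpace ℝ (StrongDual ℝ X) (dualOperator T (s n)))
    (Filter.Eventually.of_forall (f := (hyperfilter ℕ : Filter ℕ)) fun n =>
      subset_closure ⟨_, ⟨s n, ⟨hs0 n, hsf n⟩, rfl⟩, rfl⟩)
  obtain ⟨y, rfl⟩ := (toWeakSpace ℝ (StrongDual ℝ X)).surjective ξ
  have hy : ∀ L : StrongDual ℝ (StrongDual ℝ X),
      Tendsto (fun n => L (dualOperator T (s n))) (hyperfilter ℕ : Filter ℕ) (𝓝 (L y)) :=
    tendsto_toWeakSpace_iff.1 hξ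
  have hyF : y = dualOperator T F := by
    ext x
    exact tendsto_nhds_unique (hy (NormedSpace.inclusionInDoubleDual ℝ X x)) ((hF (T x)).mono_left hat)
  rw [← hyF]
  exact tendsto_nhds_unique (hy L) (hc.mono_left hat)

/-- A gliding diagonal is excluded by the Schur argument: weak compactness exchanges limits in the
ball of `X` with infinite sums of the functionals. -/
theorem IsOrderWeaklyCompactOperator.tendsto_norm {T : X →L[ℝ] E}
    (hT : IsOrderWeaklyCompactOperator (dualOperator T)) (f : StrongDual ℝ E)
    (g : ℕ → StrongDual ℝ E) (hg0 : ∀ n, 0 ≤ g n) (hgf : ∀ n, g n ≤ f) (hd : IsDisjointSeq g) :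
    Tendsto (fun n => ‖dualOperator T (g n)‖) atTop (𝓝 0) := by
  by_contra hcon
  obtain ⟨ε, hε, hfr⟩ : ∃ ε > 0, ∃ᶠ n in atTop, ε ≤ ‖dualOperator T (g n)‖ := by
    rw [Metric.tendsto_nhds] at hcon
    push Not at hcon
    obtain ⟨ε, hε, h⟩ := hcon
    refine ⟨ε, hε, h.mono fun n hn => ?_⟩
    rwa [Real.dist_0_eq_abs, abs_norm] at hn
  obtain ⟨φ, hφ, hφε⟩ := extraction_of_frequently_atTop hfr
  have hgs := sum_dual_le_of_isDisjointSeq (g := g ∘ φ) (fun n => hg0 _) (hd.comp hφ.injective)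
    (fun n => hgf _)
  replace hg0 : ∀ n, 0 ≤ (g ∘ φ) n := fun n => hg0 _
  generalize hk : g ∘ φ = k at hgs hg0
  replace hφε : ∀ n, ε ≤ ‖dualOperator T (k n)‖ := fun n => by rw [← hk]; exact hφε n
  have hb : ∀ n, ∃ b : X, ‖b‖ ≤ 1 ∧ ε / 2 < |k n (T b)| := by
    intro n
    obtain ⟨b, hb, h⟩ := (dualOperator T (k n)).exists_lt_apply_of_lt_opNorm
      ((half_lt_self hε).trans_le (hφε n))
    exact ⟨b, hb.le, h⟩
  choose b hb1 hb using hb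
  have hfT : ∀ m, f |T (b m)| ≤ ‖f‖ * ‖T‖ := fun m => by
    have h1 := (le_abs_self _).trans (f.le_opNorm |T (b m)|)
    rw [norm_abs_eq_norm] at h1
    exact h1.trans (mul_le_mul_of_nonneg_left (T.unit_le_opNorm _ (hb1 m)) (norm_nonneg f))
  have hsumle : ∀ (s : Finset ℕ) m, ∑ n ∈ s, |k n (T (b m))| ≤ ‖f‖ * ‖T‖ := fun s m =>
    (sum_abs_apply_le hg0 hgs s _).trans (hfT m)
  -- A diagonal subsequence gives a limit `c n` in each coordinate; the uniform bound on the sums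
  -- makes `c` summable.
  obtain ⟨c, -, ψ, hψ, hc⟩ := (isCompact_univ_pi fun _ : ℕ =>
    isCompact_Icc (a := -(‖f‖ * ‖T‖)) (b := ‖f‖ * ‖T‖)).tendsto_subseq
    (x := fun m n => k n (T (b m))) fun m n _ => by
      have := hsumle {n} m
      rw [Finset.sum_singleton] at this
      exact abs_le.1 this
  have hc' : ∀ n, Tendsto (fun m => k n (T (b (ψ m)))) atTop (𝓝 (c n)) := fun n =>
    (tendsto_pi_nhds.1 hc) n
  have hcs : Summable fun n => |c n| := summable_of_sum_le (fun _ => abs_nonneg _) fun s =>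
    le_of_tendsto' (tendsto_finsetSum s fun n _ => (hc' n).abs) fun m => hsumle s _
  have hsummable : ∀ m, Summable fun n => k n (T (b (ψ m))) := fun m =>
    (summable_abs_apply hg0 hgs _).of_abs
  have hschur := tendsto_zero_uniformly_of_tsum_indicator
    (b := fun m n => k n (T (b (ψ m))) - c n) (fun m => (hsummable m).sub hcs.of_abs)
    (fun a => by
      obtain ⟨F, hF⟩ := exists_dual_eq_tsum_indicator hg0 hgs a
      have key : Tendsto (fun m => F (T (b (ψ m)))) atTop (𝓝 (∑' n, a.indicator c n)) := by
        -- Along each ultrafilter the chosen points converge weak* to some `L` in `X''`, whose value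
        -- at the adjoint image of `F` is the sum of the `c n` over `a`.
        rw [tendsto_iff_ultrafilter]
        intro U hU
        obtain ⟨L, -, hL⟩ := exists_ultrafilter_limit U
          (g := fun m => NormedSpace.inclusionInDoubleDual ℝ X (b (ψ m))) (C := 1)
          fun m => (NormedSpace.double_dual_bound ℝ X _).trans (hb1 _)
        have hLk : ∀ n, L (dualOperator T (k n)) = c n := fun n =>
          tendsto_nhds_unique (hL _) ((hc' n).mono_left hU)
        have h1 := hT.bidual_apply_eq (F := F) (f := f)
          (s := fun N => ∑ n ∈ Finset.range N, a.indicator k n) (fun N => ?_) (fun N => ?_)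
          (fun x => ?_) L (c := ∑' n, a.indicator c n) ?_
        · rw [← h1]
          exact hL _
        · exact Finset.sum_nonneg fun n _ => Set.indicator_nonneg (fun i _ => hg0 i) n
        · exact (Finset.sum_le_sum fun n _ => Set.indicator_le_self' (fun i _ => hg0 i) n).trans
            (hgs _)
        · have h2 := ((summable_abs_apply hg0 hgs x).of_abs.indicator a).hasSum.tendsto_sum_nat
          rw [← hF] at h2
          refine h2.congr fun N => ?_
          rw [sum_apply]
          refine Finset.sum_congr rfl fun n _ => ?_
          by_cases hn : n ∈ a <;> simp [hn]
        · have h2 := (hcs.of_abs.indicator a).hasSum.tendsto_sum_nat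
          refine h2.congr fun N => ?_
          rw [map_sum, map_sum]
          refine Finset.sum_congr rfl fun n _ => ?_
          by_cases hn : n ∈ a <;> simp [hn, hLk]
      have h3 := key.sub_const (∑' n, a.indicator c n)
      rw [sub_self] at h3
      refine h3.congr fun m => ?_
      rw [hF, ← ((hsummable m).indicator a).tsum_sub (hcs.of_abs.indicator a)]
      refine tsum_congr fun n => ?_
      by_cases hn : n ∈ a <;> simp [hn]) (ε := ε / 4) (by positivity)
  -- On the diagonal `n = ψ m`, this and the uniform estimate force a value below `ε / 2`, against
  -- the choice of `b`.
  have h4 : ∀ᶠ m in atTop, |c (ψ m)| < ε / 4 :=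
    (hcs.tendsto_atTop_zero.comp hψ.tendsto_atTop).eventually_lt_const (by positivity)
  obtain ⟨m, hm1, hm2⟩ := (hschur.and h4).exists
  have h5 := hb (ψ m)
  have h6 := hm1 (ψ m)
  have h7 := abs_sub_abs_le_abs_sub (k (ψ m) (T (b (ψ m)))) (c (ψ m))
  linarith

end OrderWeaklyCompact

/-! ### Disjointly weakly compact operators have order weakly compact adjoints -/

theorem locallyConvexSpace_weakDual (Y : Type*) [NormedAddCommGroup Y] [NormedSpace ℝ Y] :
    LocallyConvexSpace ℝ (WeakDual ℝ Y) :=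
  (WeakDual.withSeminorms ℝ Y).toLocallyConvexSpace

/-- Weak* continuous functionals are evaluations. -/
theorem exists_eq_eval_weakDual {Y : Type*} [NormedAddCommGroup Y] [NormedSpace ℝ Y]
    (l : StrongDual ℝ (WeakDual ℝ Y)) : ∃ φ : Y, ∀ M : WeakDual ℝ Y, l M = M φ := by
  let B : StrongDual ℝ Y →ₗ[ℝ] Y →ₗ[ℝ] ℝ := topDualPairing ℝ Y
  let l' : StrongDual ℝ (WeakBilin B) := l
  obtain ⟨φ, hφ⟩ := LinearMap.dualEmbedding_surjective B l'
  exact ⟨φ, fun M => (DFunLike.congr_fun hφ M).symm⟩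

/-- Goldstine's theorem. -/
theorem mem_closure_inclusionInDoubleDual {X : Type*} [NormedAddCommGroup X] [NormedSpace ℝ X]
    {L : StrongDual ℝ (StrongDual ℝ X)} (hL : ‖L‖ ≤ 1) :
    StrongDual.toWeakDual L ∈ closure ((fun b : X => StrongDual.toWeakDual
      (NormedSpace.inclusionInDoubleDual ℝ X b)) '' Metric.closedBall 0 1) := by
  have := locallyConvexSpace_weakDual (StrongDual ℝ X)
  by_contra hcon
  have hconv : Convex ℝ ((fun b : X => StrongDual.toWeakDual
      (NormedSpace.inclusionInDoubleDual ℝ X b)) '' Metric.closedBall 0 1) :=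
    (convex_closedBall (0 : X) 1).is_linear_image
      (f := fun b : X => StrongDual.toWeakDual (NormedSpace.inclusionInDoubleDual ℝ X b))
      ⟨fun x y => by rw [map_add, map_add], fun c x => by rw [map_smul, map_smul]⟩
  obtain ⟨ℓ, s, hs, hsL⟩ := geometric_hahn_banach_closed_point hconv.closure isClosed_closure hcon
  obtain ⟨φ, hφ⟩ := exists_eq_eval_weakDual ℓ
  have hφL : ∀ M : StrongDual ℝ (StrongDual ℝ X), ℓ (StrongDual.toWeakDual M) = M φ := fun M => hφ _
  have h1 : ∀ b : X, ‖b‖ ≤ 1 → φ b < s := fun b hb => by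
    have := hs _ (subset_closure ⟨b, by simpa using hb, rfl⟩)
    rw [hφL] at this
    exact this
  have h0 : 0 < s := by simpa using h1 0 (by simp)
  have h2 : ‖φ‖ ≤ s := by
    refine ContinuousLinearMap.opNorm_le_of_unit_norm h0.le fun b hb => ?_
    have h3 := h1 b hb.le
    have h4 := h1 (-b) (by rw [norm_neg]; exact hb.le)
    rw [map_neg] at h4
    exact abs_le.2 ⟨by linarith, h3.le⟩
  rw [hφL] at hsL
  have h3 := (le_abs_self _).trans (L.le_opNorm φ)
  have h4 := mul_le_mul_of_nonneg_right hL (norm_nonneg φ)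
  linarith

/-- Goldstine's theorem in terms of a filter with a basis of convex sets. -/
theorem exists_filter_tendsto_bidual {X : Type*} [NormedAddCommGroup X] [NormedSpace ℝ X]
    {L : StrongDual ℝ (StrongDual ℝ X)} (hL : ‖L‖ ≤ 1) :
    ∃ 𝓕 : Filter X, 𝓕.NeBot ∧ (∀ W ∈ 𝓕, ∃ W' ∈ 𝓕, W' ⊆ W ∧ Convex ℝ W') ∧
      (∀ᶠ b in 𝓕, ‖b‖ ≤ 1) ∧ ∀ φ : StrongDual ℝ X, Tendsto (fun b => φ b) 𝓕 (𝓝 (L φ)) := by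
  have := locallyConvexSpace_weakDual (StrongDual ℝ X)
  let J : X →ₗ[ℝ] WeakDual ℝ (StrongDual ℝ X) :=
    StrongDual.toWeakDual.toLinearMap ∘ₗ (NormedSpace.inclusionInDoubleDual ℝ X).toLinearMap
  refine ⟨comap J (𝓝 (StrongDual.toWeakDual L)) ⊓ 𝓟 (Metric.closedBall 0 1), ?_, ?_, ?_, ?_⟩
  · rw [inf_principal_neBot_iff]
    rintro W ⟨V, hV, hVW⟩
    obtain ⟨_, h1, b, hb, rfl⟩ := mem_closure_iff_nhds.1 (mem_closure_inclusionInDoubleDual hL) V hV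
    exact ⟨b, hVW h1, hb⟩
  · intro W hW
    obtain ⟨V, ⟨hV, hVc⟩, hVW⟩ :=
      (((LocallyConvexSpace.convex_basis (𝕜 := ℝ) (StrongDual.toWeakDual L)).comap J).inf_principal
        (Metric.closedBall 0 1)).mem_iff.1 hW
    exact ⟨_, inter_mem_inf (preimage_mem_comap hV) (mem_principal_self _), hVW,
      (hVc.linear_preimage J).inter (convex_closedBall _ _)⟩
  · filter_upwards [mem_inf_of_right (mem_principal_self _)] with b hb
    simpa using hb
  · intro φ
    exact ((WeakDual.eval_continuous φ).tendsto (StrongDual.toWeakDual L)).comp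
      (tendsto_comap.mono_left inf_le_left)

/-- A lattice substitute for the square: a function on a vector lattice, uniformly convex
on `[-u, u]` at scale `δ`. -/
theorem exists_uniformly_convex {E : Type*} [Lattice E] [AddCommGroup E] [IsOrderedAddMonoid E]
    [Module ℝ E] [IsOrderedModule ℝ E] {u : E} (hu : 0 ≤ u) {N : ℕ} (hN : 0 < N) :
    ∃ φ : E → E, (∀ a, 0 ≤ φ a) ∧ (∀ a, φ a ≤ (2 : ℝ) • |a|) ∧ ∀ a b,
      (2 : ℝ) • φ ((1 / 2 : ℝ) • (a + b)) + (2 * (1 / N : ℝ)) • |a - b| ≤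
        φ a + φ b + (2 * (1 / N : ℝ) ^ 2) • u + (2 * (1 / N : ℝ)) • (|a| - u)⁺ +
          (2 * (1 / N : ℝ)) • (|b| - u)⁺ := by
  set δ : ℝ := 1 / N with hδ
  have hN' : (0 : ℝ) < N := Nat.cast_pos.2 hN
  have hδ0 : 0 < δ := by positivity
  have hNδ : (N : ℝ) * δ = 1 := by rw [hδ]; field_simp
  -- With `u = 1`, these are the tangent lines `2ta - t²` of the square. Their supremum over a grid
  -- of step `δ` in `[-1, 1]` needs only lattice operations.
  let τ : ℝ → E → E := fun t a => (2 * t) • a - t ^ 2 • u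
  let I : Finset ℤ := Finset.Icc (-(N : ℤ)) N
  have h0I : (0 : ℤ) ∈ I := by simp [I]
  let φ : E → E := fun a => I.sup' ⟨0, h0I⟩ fun i => τ (i * δ) a
  have hle : ∀ a, ∀ i ∈ I, τ (i * δ) a ≤ φ a := fun a i hi =>
    Finset.le_sup' (fun i : ℤ => τ (i * δ) a) hi
  have hr : ∀ a, 0 ≤ (2 * δ) • (|a| - u)⁺ := fun a =>
    smul_nonneg (by positivity) (posPart_nonneg _)
  have habs : ∀ (t : ℝ) (a : E), t • a ≤ |t| • |a| := fun t a => by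
    rcases le_total 0 t with ht | ht
    · rw [abs_of_nonneg ht]
      exact smul_le_smul_of_nonneg_left (le_abs_self a) ht
    · rw [abs_of_nonpos ht, ← neg_smul_neg]
      exact smul_le_smul_of_nonneg_left (neg_le_abs a) (neg_nonneg.2 ht)
  -- A slope one step outside the grid costs only the excess of `|a|` over `u`.
  have hstep : ∀ (t : ℝ) (a : E), |t| = 1 → τ (t + t * δ) a ≤ τ t a + (2 * δ) • (|a| - u)⁺ := by
    intro t a ht
    have ht2 : t ^ 2 = 1 := by rw [← sq_abs, ht, one_pow]
    have h1 : τ (t + t * δ) a = τ t a + ((2 * δ) • (t • a - u) - δ ^ 2 • u) := by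
      have : (t + t * δ) ^ 2 = 1 + 2 * δ + δ ^ 2 := by
        rw [show (t + t * δ) ^ 2 = t ^ 2 * (1 + 2 * δ + δ ^ 2) by ring, ht2, one_mul]
      simp only [τ, this, ht2]
      module
    rw [h1]
    refine add_le_add le_rfl ((sub_le_self _ (smul_nonneg (by positivity) hu)).trans
      (smul_le_smul_of_nonneg_left ?_ (by positivity)))
    have h2 := habs t a
    rw [ht, one_smul] at h2
    exact (sub_le_sub_right h2 u).trans (le_posPart _)
  have hup : ∀ a, ∀ i ∈ I, τ (i * δ + δ) a ≤ φ a + (2 * δ) • (|a| - u)⁺ := by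
    intro a i hi
    rcases eq_or_ne i (N : ℤ) with rfl | hne
    · have h1 : (((N : ℤ) : ℝ)) * δ = 1 := by rw [Int.cast_natCast, hNδ]
      have h2 := hstep 1 a abs_one
      have h3 := hle a N hi
      rw [h1] at h3 ⊢
      rw [one_mul] at h2
      exact h2.trans (add_le_add h3 le_rfl)
    · have hi' : i + 1 ∈ I := by
        simp only [I, Finset.mem_Icc] at hi ⊢
        omega
      have h1 := hle a _ hi'
      rw [Int.cast_add, Int.cast_one, add_mul, one_mul] at h1
      exact h1.trans (le_add_of_nonneg_right (hr a))
  have hdown : ∀ a, ∀ i ∈ I, τ (i * δ - δ) a ≤ φ a + (2 * δ) • (|a| - u)⁺ := by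
    intro a i hi
    rcases eq_or_ne i (-(N : ℤ)) with rfl | hne
    · have h1 : ((-(N : ℤ) : ℤ) : ℝ) * δ = -1 := by
        rw [Int.cast_neg, Int.cast_natCast, neg_mul, hNδ]
      have h2 := hstep (-1) a (by rw [abs_neg, abs_one])
      have h3 := hle a _ hi
      rw [h1] at h3 ⊢
      rw [neg_one_mul, ← sub_eq_add_neg] at h2
      exact h2.trans (add_le_add h3 le_rfl)
    · have hi' : i - 1 ∈ I := by
        simp only [I, Finset.mem_Icc] at hi ⊢
        omega
      have h1 := hle a _ hi'
      rw [Int.cast_sub, Int.cast_one, sub_mul, one_mul] at h1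
      exact h1.trans (le_add_of_nonneg_right (hr a))
  refine ⟨φ, fun a => ?_, fun a => ?_, fun a b => ?_⟩
  · have := hle a 0 h0I
    simpa [τ] using this
  · refine Finset.sup'_le _ _ fun i hi => ?_
    refine (sub_le_self _ (smul_nonneg (sq_nonneg _) hu)).trans ((habs _ a).trans
      (smul_le_smul_of_nonneg_right ?_ (abs_nonneg a)))
    have h1 : |(i : ℝ)| ≤ N := by
      simp only [I, Finset.mem_Icc] at hi
      rw [abs_le]
      exact ⟨by exact_mod_cast hi.1, by exact_mod_cast hi.2⟩
    rw [abs_mul, abs_mul, abs_of_pos hδ0, abs_two]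
    have h2 := mul_le_mul_of_nonneg_right h1 hδ0.le
    rw [hNδ] at h2
    linarith
  · set R := φ a + φ b + (2 * δ ^ 2) • u + (2 * δ) • (|a| - u)⁺ + (2 * δ) • (|b| - u)⁺ with hR
    have key : ∀ w : E, (∀ i ∈ I, (2 : ℝ) • τ (i * δ) ((1 / 2 : ℝ) • (a + b)) + w ≤ R) →
        w ≤ R - (2 : ℝ) • φ ((1 / 2 : ℝ) • (a + b)) := by
      intro w hw
      have h1 : φ ((1 / 2 : ℝ) • (a + b)) ≤ (1 / 2 : ℝ) • (R - w) := by
        refine Finset.sup'_le _ _ fun i hi => ?_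
        have h2 := smul_le_smul_of_nonneg_left (le_sub_iff_add_le.2 (hw i hi))
          (by norm_num : (0 : ℝ) ≤ 1 / 2)
        rwa [smul_smul, one_div_mul_cancel two_ne_zero, one_smul] at h2
      have h2 := smul_le_smul_of_nonneg_left h1 (zero_le_two (α := ℝ))
      rw [smul_smul, mul_one_div_cancel two_ne_zero, one_smul] at h2
      exact le_sub_comm.1 h2
    rw [add_comm, ← le_sub_iff_add_le]
    have h2δ : (0 : ℝ) < 2 * δ := by positivity
    rw [← le_inv_smul_iff_of_pos h2δ]
    refine abs_le'.2 ⟨(le_inv_smul_iff_of_pos h2δ).2 (key _ fun i hi => ?_),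
      (le_inv_smul_iff_of_pos h2δ).2 (key _ fun i hi => ?_)⟩
    -- Twice the tangent of slope `t` at the midpoint plus `2δ(a - b)` equals the tangent of slope
    -- `t + δ` at `a` plus that of slope `t - δ` at `b`, up to `2δ²u`.
    · have h2 := add_le_add (hup a i hi) (hdown b i hi)
      have h3 := add_le_add_left h2 ((2 * δ ^ 2) • u)
      calc _ = τ (i * δ + δ) a + τ (i * δ - δ) b + (2 * δ ^ 2) • u := by
            simp only [τ]; module
        _ ≤ _ := h3
        _ = R := by rw [hR]; abel
    · have h2 := add_le_add (hdown a i hi) (hup b i hi)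
      have h3 := add_le_add_left h2 ((2 * δ ^ 2) • u)
      calc _ = τ (i * δ - δ) a + τ (i * δ + δ) b + (2 * δ ^ 2) • u := by
            simp only [τ]; module
        _ ≤ _ := h3
        _ = R := by rw [hR]; abel

/-! ### Operators -/

section Main

variable {X E : Type*} [NormedAddCommGroup X] [NormedSpace ℝ X]
  [NormedAddCommGroup E] [Lattice E] [IsOrderedAddMonoid E] [HasSolidNorm E] [NormedSpace ℝ E]
  [IsOrderedModule ℝ E]

/-- If `T` maps the unit ball to an `f`-equi-integrable set, then on `[0, f]` every functional
`T'' L` with `‖L‖ ≤ 1` is uniformly approximated by elements of the image of the ball. -/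
theorem exists_forall_abs_bidual_sub_apply_le {T : X →L[ℝ] E} {f : StrongDual ℝ E} (hf : 0 ≤ f)
    {u : E} (hu : 0 ≤ u) {ε : ℝ} (hε : 0 < ε)
    (hui : ∀ b : X, ‖b‖ ≤ 1 → f (|T b| - u)⁺ ≤ ε) {L : StrongDual ℝ (StrongDual ℝ X)}
    (hL : ‖L‖ ≤ 1) :
    ∃ b : X, ∀ h : StrongDual ℝ E, 0 ≤ h → h ≤ f →
      |L (dualOperator T h) - h (T b)| ≤ 6 * ε := by
  obtain ⟨𝓕, h𝓕, hconv, hball, hlim⟩ := exists_filter_tendsto_bidual hL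
  obtain ⟨N, hN⟩ := exists_nat_gt (f u / ε)
  have hfu : 0 ≤ f u := apply_nonneg hf hu
  have hN' : (0 : ℝ) < N := lt_of_le_of_lt (by positivity) hN
  obtain ⟨φ, hφ0, hφ2, hφ⟩ := exists_uniformly_convex hu (Nat.cast_pos.1 hN')
  set δ : ℝ := 1 / N with hδ
  have hδ0 : 0 < δ := by positivity
  have hδu : δ * f u ≤ ε := by
    rw [div_lt_iff₀ hε] at hN
    rw [hδ, one_div, inv_mul_le_iff₀ hN']
    exact hN.le
  let r : X → ℝ := fun b => f (φ (T b))
  have hr0 : ∀ b, 0 ≤ r b := fun b => apply_nonneg hf (hφ0 _)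
  have hr : ∀ b b' : X, ‖b‖ ≤ 1 → ‖b'‖ ≤ 1 → 2 * r ((1 / 2 : ℝ) • (b + b')) +
      2 * δ * f |T b - T b'| ≤ r b + r b' + 2 * δ ^ 2 * f u + 2 * δ * ε + 2 * δ * ε := by
    intro b b' hb hb'
    have h1 := apply_mono hf (hφ (T b) (T b'))
    simp only [map_add, map_smul, smul_eq_mul] at h1
    have h2 := mul_le_mul_of_nonneg_left (hui b hb) (by positivity : 0 ≤ 2 * δ)
    have h3 := mul_le_mul_of_nonneg_left (hui b' hb') (by positivity : 0 ≤ 2 * δ)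
    have h4 : r ((1 / 2 : ℝ) • (b + b')) = f (φ ((1 / 2 : ℝ) • (T b + T b'))) := by
      simp only [r, map_add, map_smul]
    rw [h4]
    linarith
  let S : Set ℝ := {c | ∀ᶠ b in 𝓕, c ≤ r b}
  have hS0 : (0 : ℝ) ∈ S := Eventually.of_forall hr0
  have hSb : BddAbove S := by
    refine ⟨2 * (‖f‖ * ‖T‖), fun c hc => ?_⟩
    have hc' : ∀ᶠ b in 𝓕, c ≤ r b := hc
    obtain ⟨b, hb, hb1⟩ := (hc'.and hball).exists
    have h1 := apply_mono hf (hφ2 (T b))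
    rw [map_smul, smul_eq_mul] at h1
    have h2 := (le_abs_self _).trans (f.le_opNorm |T b|)
    rw [norm_abs_eq_norm] at h2
    have h3 := mul_le_mul_of_nonneg_left (T.unit_le_opNorm b hb1) (norm_nonneg f)
    exact hb.trans (h1.trans (by linarith))
  -- `α` is the lower limit of `r` along the filter: eventually `r` is almost at least `α`, and
  -- frequently almost at most `α`.
  set α := sSup S
  have hδε : 0 < δ * ε := by positivity
  have hlow : ∀ᶠ b in 𝓕, α - δ * ε ≤ r b := by
    obtain ⟨c, hc, hlt⟩ := exists_lt_of_lt_csSup ⟨0, hS0⟩ (sub_lt_self α hδε)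
    have hc' : ∀ᶠ b in 𝓕, c ≤ r b := hc
    exact hc'.mono fun b hb => hlt.le.trans hb
  have hhigh : ∃ᶠ b in 𝓕, r b ≤ α + δ * ε := by
    intro hcon
    have h1 : α + δ * ε ∈ S := hcon.mono fun b hb => (not_le.1 hb).le
    have := le_csSup hSb h1
    linarith
  obtain ⟨W, hW, hWsub, hWc⟩ := hconv _ hlow
  obtain ⟨b, hbr, hb1, hbW⟩ := (hhigh.and_eventually (hball.and hW)).exists
  refine ⟨b, fun h h0 hhf => ?_⟩
  have hclose : ∀ᶠ b' in 𝓕, |h (T b') - L (dualOperator T h)| < ε := by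
    have := Metric.tendsto_nhds.1 (hlim (dualOperator T h)) ε hε
    exact this
  -- Only `b'` depends on `h`. Both points nearly minimise `r` on the convex set `W`, as does their
  -- midpoint, so uniform convexity bounds `f |T b - T b'|` by `5 * ε`.
  obtain ⟨b', hbr', hb1', hbW', hb'⟩ :=
    (hhigh.and_eventually (hball.and ((show ∀ᶠ b in 𝓕, b ∈ W from hW).and hclose))).exists
  have hmid : α - δ * ε ≤ r ((1 / 2 : ℝ) • (b + b')) := by
    refine hWsub ?_
    rw [smul_add]
    exact hWc hbW hbW' (by norm_num) (by norm_num) (by norm_num)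
  have h1 := hr b b' hb1 hb1'
  have h2 : 2 * δ ^ 2 * f u ≤ 2 * δ * ε := by
    have := mul_le_mul_of_nonneg_left hδu (by positivity : 0 ≤ 2 * δ)
    calc 2 * δ ^ 2 * f u = 2 * δ * (δ * f u) := by ring
      _ ≤ _ := this
  have h3 : δ * f |T b - T b'| ≤ δ * (5 * ε) := by linarith
  have h4 := le_of_mul_le_mul_left h3 hδ0
  have h5 : |h (T b - T b')| ≤ 5 * ε := (apply_abs_le_of_nonneg h0 hhf _).trans h4
  rw [map_sub] at h5
  have h6 : L (dualOperator T h) - h (T b) =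
      -(h (T b') - L (dualOperator T h)) - (h (T b) - h (T b')) := by ring
  rw [h6]
  refine (abs_sub _ _).trans ?_
  rw [abs_neg]
  linarith

/-- A weak* cluster point `ζ` in the third dual is compared with the weak* limit `g` of the same
functionals in `[0, f]`. Uniform approximation by one `T b` permits exchanging the limits, so `ζ` is
the adjoint image of `g`. -/
theorem isOrderWeaklyCompactOperator_dualOperator {T : X →L[ℝ] E}
    (H : ∀ f : StrongDual ℝ E, 0 ≤ f → ∀ ε : ℝ, 0 < ε →
      ∃ u : E, 0 ≤ u ∧ ∀ b : X, ‖b‖ ≤ 1 → f (|T b| - u)⁺ ≤ ε) :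
    IsOrderWeaklyCompactOperator (dualOperator T) := by
  intro f hf
  have hnorm : ∀ h ∈ Set.Icc 0 f, ‖h‖ ≤ ‖f‖ := fun h hh =>
    norm_le_of_abs_apply_le_apply_abs fun x => apply_abs_le_of_nonneg hh.1 hh.2 x
  apply NormedSpace.isCompact_closure_of_isBounded
  · rw [isBounded_iff_forall_norm_le]
    refine ⟨‖dualOperator T‖ * ‖f‖, ?_⟩
    rintro y ⟨_, ⟨h, hh, rfl⟩, hy⟩
    obtain rfl : dualOperator T h = y := hy
    exact ((dualOperator T).le_opNorm h).trans
      (mul_le_mul_of_nonneg_left (hnorm h hh) (norm_nonneg _))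
  · intro ζ hζ
    let m : Set.Icc 0 f → WeakDual ℝ (StrongDual ℝ (StrongDual ℝ X)) := fun h =>
      NormedSpace.inclusionInDoubleDualWeak ℝ (StrongDual ℝ X)
        (toWeakSpace ℝ _ (dualOperator T h))
    have hne : (comap m (𝓝 ζ)).NeBot := by
      rw [comap_neBot_iff]
      intro V hV
      obtain ⟨_, h1, _, ⟨_, ⟨h, hh, rfl⟩, rfl⟩, rfl⟩ := mem_closure_iff_nhds.1 hζ V hV
      exact ⟨⟨h, hh⟩, h1⟩
    let U : Ultrafilter (Set.Icc 0 f) := Ultrafilter.of (comap m (𝓝 ζ))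
    have hU : Tendsto m U (𝓝 ζ) := tendsto_iff_comap.2 (Ultrafilter.of_le _)
    have hUL : ∀ L : StrongDual ℝ (StrongDual ℝ X),
        Tendsto (fun h : Set.Icc 0 f => L (dualOperator T h)) U (𝓝 (ζ L)) := fun L =>
      ((WeakDual.eval_continuous L).tendsto ζ).comp hU
    obtain ⟨g, -, hg⟩ := exists_ultrafilter_limit U (g := fun h : Set.Icc 0 f => (h : StrongDual ℝ E))
      (C := ‖f‖) fun h => hnorm _ h.2
    have hg0 : 0 ≤ g := fun x hx => ge_of_tendsto' (hg x) fun h => h.2.1 x hx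
    have hgf : g ≤ f := fun x hx => le_of_tendsto' (hg x) fun h => h.2.2 x hx
    have hball : ∀ L : StrongDual ℝ (StrongDual ℝ X), ‖L‖ ≤ 1 → ζ L = L (dualOperator T g) := by
      intro L hL
      refine eq_of_forall_dist_le fun ε hε => ?_
      obtain ⟨u, hu, hui⟩ := H f hf (ε / 12) (by positivity)
      obtain ⟨b, hb⟩ := exists_forall_abs_bidual_sub_apply_le hf hu (by positivity) hui hL
      have h1 : |ζ L - g (T b)| ≤ 6 * (ε / 12) :=
        le_of_tendsto' ((hUL L).sub (hg (T b))).abs fun h => hb h h.2.1 h.2.2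
      have h2 := hb g hg0 hgf
      rw [Real.dist_eq]
      have h3 : ζ L - L (dualOperator T g) =
          (ζ L - g (T b)) - (L (dualOperator T g) - g (T b)) := by ring
      rw [h3]
      exact (abs_sub _ _).trans (by linarith)
    refine ⟨toWeakSpace ℝ _ (dualOperator T g), ?_⟩
    refine DFunLike.ext _ _ fun L => ?_
    change L (dualOperator T g) = ζ L
    have hpos : 0 < ‖L‖ + 1 := by positivity
    -- Scaling into the unit ball extends the identity to all `L`.
    have h1 := hball ((‖L‖ + 1)⁻¹ • L) (by
      refine (ContinuousLinearMap.opNorm_smul_le _ _).trans ?_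
      rw [Real.norm_of_nonneg (inv_nonneg.2 hpos.le), inv_mul_le_iff₀ hpos]
      linarith)
    rw [map_smul] at h1
    have h2 : (‖L‖ + 1)⁻¹ * ζ L = (‖L‖ + 1)⁻¹ * L (dualOperator T g) := h1
    exact (mul_left_cancel₀ (inv_ne_zero hpos.ne') h2).symm

/-- Anything dominated by a disjoint sequence in the solid hull is again such a sequence, hence
weakly null. So the functionals need only be tested on `y` all of whose dominated sequences are
weakly null. -/
theorem IsDisjointlyWeaklyCompactOperator.exists_forall_apply_posPart_sub_le [CompleteSpace E]
    {T : X →L[ℝ] E} {G : Set (StrongDual ℝ E)} {C : ℝ} (hG : ∀ g ∈ G, 0 ≤ g)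
    (hC : ∀ g ∈ G, ‖g‖ ≤ C)
    (h : ∀ y : ℕ → E, (∀ k, 0 ≤ y k) → (∀ z : ℕ → E, (∀ k, |z k| ≤ y k) → IsWeaklyNull z) →
      ∀ g : ℕ → StrongDual ℝ E, (∀ k, g k ∈ G) → Tendsto (fun k => g k (y k)) atTop (𝓝 0))
    (hT : IsDisjointlyWeaklyCompactOperator T) {ε : ℝ} (hε : 0 < ε) :
    ∃ u : E, 0 ≤ u ∧ ∀ b : X, ‖b‖ ≤ 1 → ∀ g ∈ G, g (|T b| - u)⁺ ≤ ε := by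
  obtain ⟨R, hR⟩ := isBounded_iff_forall_norm_le.1 hT.1
  obtain ⟨u, hu, hui⟩ := _root_.exists_forall_apply_posPart_sub_le hR hG hC
    (fun y hy0 hys hyd g hg => h y hy0 (fun z hz => by
      have hz' : ∀ k, |z k| ≤ |y k| := fun k => by rw [abs_of_nonneg (hy0 k)]; exact hz k
      refine hT.2 z (fun k => ?_) (hyd.of_abs_le hz')
      obtain ⟨a, ha, hya⟩ := hys k
      exact ⟨a, ha, (hz' k).trans hya⟩) g hg) hε
  exact ⟨u, hu, fun b hb => hui _ ⟨b, by simpa using hb, rfl⟩⟩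

/-- Norm convergence on a sequence whose moduli are weak* null and null on weakly null solid
sequences. -/
theorem IsDisjointlyWeaklyCompactOperator.tendsto_norm [CompleteSpace E]
    {T : X →L[ℝ] E} (hT : IsDisjointlyWeaklyCompactOperator T) {f g : ℕ → StrongDual ℝ E}
    {C : ℝ} (hfg : ∀ n, |f n| ≤ g n) (hC : ∀ n, ‖g n‖ ≤ C)
    (hg : ∀ x : E, 0 ≤ x → Tendsto (fun n => g n x) atTop (𝓝 0))
    (h : ∀ y : ℕ → E, (∀ k, 0 ≤ y k) → (∀ z : ℕ → E, (∀ k, |z k| ≤ y k) → IsWeaklyNull z) →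
      ∀ m : ℕ → ℕ, Tendsto (fun k => g (m k) (y k)) atTop (𝓝 0)) :
    Tendsto (fun n => ‖dualOperator T (f n)‖) atTop (𝓝 0) := by
  have hg0 : ∀ n, 0 ≤ g n := fun n => (abs_nonneg _).trans (hfg n)
  rw [Metric.tendsto_nhds]
  intro ε hε
  obtain ⟨u, hu, hui⟩ := hT.exists_forall_apply_posPart_sub_le (G := Set.range g) (C := C)
    (by rintro _ ⟨n, rfl⟩; exact hg0 n) (by rintro _ ⟨n, rfl⟩; exact hC n)
    (fun y hy0 hy G hG => by
      choose m hm using hG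
      simpa only [hm] using h y hy0 hy m) (ε := ε / 3) (by positivity)
  filter_upwards [(hg u hu).eventually_lt_const (by positivity : 0 < ε / 3)] with n hn
  rw [Real.dist_0_eq_abs, abs_norm]
  refine lt_of_le_of_lt (b := 2 * (ε / 3)) ?_ (by linarith)
  refine ContinuousLinearMap.opNorm_le_of_unit_norm (by positivity) fun b hb => ?_
  have h1 : g n |T b| ≤ g n u + g n (|T b| - u)⁺ := by
    rw [← map_add]
    exact apply_mono (hg0 n) (sub_le_iff_le_add'.1 (le_posPart _))
  have h2 := hui b hb.le _ ⟨n, rfl⟩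
  calc ‖dualOperator T (f n) b‖ = |f n (T b)| := rfl
    _ ≤ g n |T b| := abs_apply_le_of_abs_le (hfg n) _
    _ ≤ _ := by linarith

end Main
end

/-! ### The equivalences. -/

theorem theorem3p2 {X E : Type*}
    [NormedAddCommGroup X] [NormedSpace ℝ X] [CompleteSpace X]
    [NormedAddCommGroup E] [Lattice E] [IsOrderedAddMonoid E] [HasSolidNorm E]
    [NormedSpace ℝ E] [IsOrderedModule ℝ E] [CompleteSpace E]
    (T : X →L[ℝ] E) :
    [ IsDisjointlyWeaklyCompactOperator T,
      ∀ f : ℕ → StrongDual ℝ E, IsOrderBoundedSeq f → (∀ n, 0 ≤ f n) → IsWeakStarNull f →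
        Tendsto (fun n => ‖dualOperator T (f n)‖) atTop (𝓝 0),
      ∀ f : ℕ → StrongDual ℝ E, IsDisjointSeq f → IsLSequence f →
        Tendsto (fun n => ‖dualOperator T (f n)‖) atTop (𝓝 0),
      IsAlmostLLimited T,
      ∀ f : ℕ → StrongDual ℝ E, IsOrderBoundedSeq f → IsDisjointSeq f →
        Tendsto (fun n => ‖dualOperator T (f n)‖) atTop (𝓝 0),
      IsOrderWeaklyCompactOperator (dualOperator T),
      ∀ f : ℕ → StrongDual ℝ E, IsLSequence f → (∀ n, 0 ≤ f n) → IsWeakStarNull f →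
        Tendsto (fun n => ‖dualOperator T (f n)‖) atTop (𝓝 0) ].TFAE ∧
    (∀ f : ℕ → StrongDual ℝ E, IsDisjointSeq f → IsLSequence f → IsWeakStarNull f) := by
  refine ⟨?_, fun f hd hL => hL.isWeakStarNull_of_isDisjointSeq hd⟩
  have habs_null : ∀ y : ℕ → E, (∀ k, 0 ≤ y k) →
      (∀ z : ℕ → E, (∀ k, |z k| ≤ y k) → IsWeaklyNull z) → IsWeaklyNull y := fun y hy0 hy =>
    hy y fun k => (abs_of_nonneg (hy0 k)).le
  tfae_have 1 → 2 := by
    rintro hT f ⟨a, c, hac⟩ hf0 hf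
    have hfc : ∀ n, f n ≤ c := fun n => (hac n).2
    refine hT.tendsto_norm (g := f) (C := ‖c‖) (fun n => (abs_of_nonneg (hf0 n)).le)
      (fun n => DualLattice.norm_le_of_abs_apply_le_apply_abs fun x =>
        DualLattice.apply_abs_le_of_nonneg (hf0 n) (hfc n) x)
      (fun x _ => isWeakStarNull_iff.1 hf x) fun y hy0 hy m => ?_
    exact squeeze_zero (fun k => DualLattice.apply_nonneg (hf0 _) (hy0 k)) (fun k => hfc _ _ (hy0 k))
      (isWeaklyNull_iff.1 (habs_null y hy0 hy) c)
  tfae_have 1 → 3 := by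
    intro hT f hd hL
    obtain ⟨C, hC⟩ := hL.exists_norm_le
    exact hT.tendsto_norm (g := fun n => |f n|) (fun n => le_rfl)
      (fun n => (norm_abs_dual_le _).trans (hC n))
      (fun x hx => hL.tendsto_abs_apply_of_isDisjointSeq hd hx)
      fun y hy0 hy m => hL.tendsto_abs_apply hy0 hy m
  tfae_have 1 → 7 := by
    intro hT f hL hf0 hf
    obtain ⟨C, hC⟩ := hL.exists_norm_le
    exact hT.tendsto_norm (g := f) (fun n => (abs_of_nonneg (hf0 n)).le) hC
      (fun x _ => isWeakStarNull_iff.1 hf x)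
      fun y hy0 hy m => hL.tendsto_apply (habs_null y hy0 hy) m
  tfae_have 1 → 6 := by
    intro hT
    refine isOrderWeaklyCompactOperator_dualOperator fun f hf ε hε => ?_
    -- For a single functional, the sequence condition is just weak nullity of `y` tested on `f`.
    obtain ⟨u, hu, hui⟩ := hT.exists_forall_apply_posPart_sub_le (G := {f}) (C := ‖f‖)
      (by rintro _ rfl; exact hf) (by rintro _ rfl; exact le_rfl)
      (fun y hy0 hy g hg => by
        have hg' : ∀ k, g k = f := hg
        simpa only [hg'] using isWeaklyNull_iff.1 (habs_null y hy0 hy) f) hε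
    exact ⟨u, hu, fun b hb => hui b hb f rfl⟩
  tfae_have 3 → 4 := fun h f hd hL _ => h f hd hL
  tfae_have 2 → 5 := fun h => tendsto_norm_of_forall_nonneg fun f g hg0 hgf hd =>
    h g ⟨0, f, fun n => ⟨hg0 n, hgf n⟩⟩ hg0
      ((isLSequence_of_isDisjointSeq hg0 hd hgf).isWeakStarNull_of_isDisjointSeq hd)
  tfae_have 4 → 5 := fun h => tendsto_norm_of_forall_nonneg fun f g hg0 hgf hd =>
    have hL := isLSequence_of_isDisjointSeq hg0 hd hgf
    h g hd hL (hL.isWeakStarNull_of_isDisjointSeq hd)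
  tfae_have 7 → 5 := fun h => tendsto_norm_of_forall_nonneg fun f g hg0 hgf hd =>
    have hL := isLSequence_of_isDisjointSeq hg0 hd hgf
    h g hL hg0 (hL.isWeakStarNull_of_isDisjointSeq hd)
  tfae_have 6 → 5 := fun h => tendsto_norm_of_forall_nonneg fun f g hg0 hgf hd =>
    h.tendsto_norm f g hg0 hgf hd
  tfae_have 5 → 1 := isDisjointlyWeaklyCompactOperator_of_orderBounded
  tfae_finish
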